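/- **Setting.** There are $K\ge 2$ designs and an input distribution $F^c=\sum_{j=1}^D w^c_jF^c_j$ with unknown weights $w^c_j>0$, $\sum_j w^c_j=1$, and unknown components $F^c_j=G_{j,\theta^c}$, where $\{G_{j,\theta}:\theta\in\Theta\}$ are known parametric families with densities and $\Theta$ is a compact metric space ($\theta$ may be the vector of the parameters of all components). Let $X_i\mid G_{j,\theta}$ be the random performance of design $i$ when the input is drawn from $G_{j,\theta}$, with moments $y^{(k)}_{i,j}(\theta)=\mathbb E[X_i^k\mid G_{j,\theta}]$. Put $\mu_{i,j}=y^{(1)}_{i,j}(\theta^c)$, $\sigma_{i,j}^2=y^{(2)}_{i,j}(\theta^c)-\mu_{i,j}^2$, $\mu_i=\sum_j w^c_j\mu_{i,j}$ and $b=\arg\max_i\mu_i$. At stage $t=1,2,\dots$ a batch of $m(t)$ new input data arrives, $(\hat w^{(t)},\hat\theta^{(t)})$ is a maximum likelihood estimate from the $M(t)=\sum_{\tau\le t}m(\tau)$ data collected so far, and $n(t)$ simulations are run one after another; $N(t)=\sum_{\tau\le t}n(\tau)$. Before stage $1$ each pair $(i,j)$ is simulated $n_0\ge 2$ times under an initial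 guess $\hat\theta^{(0)}\in\Theta$. After $\ell$ further simulations let $N^{(\ell)}_{i,j}$ be the number of simulations of $(i,j)$ so far, $N^{(\ell)}=\sum_{i,j}N^{(\ell)}_{i,j}$, $\alpha^{(\ell)}_{i,j}=N^{(\ell)}_{i,j}/N^{(\ell)}$, $\hat\mu^{(\ell)}_{i,j},\hat\sigma^{(\ell)}_{i,j}$ the sample mean and sample standard deviation of all outputs of $(i,j)$ so far, $\hat\mu^{(\ell)}_i=\sum_j\hat w^{(t)}_j\hat\mu^{(\ell)}_{i,j}$ with $t$ the current stage, and $\hat b^{(\ell)}\in\arg\max_i\hat\mu^{(\ell)}_i$. The next pair $(I,J)$ is chosen as follows (ties in any $\arg\max$ or $\arg\min$, and choices where a formula is undefined, are arbitrary). *IU-OCBA-approx-UC*: $(I,J)\in\arg\max_{i,j}\big(\hat\alpha_{i,j}(1+N^{(\ell)})-N^{(\ell)}_{i,j}\big)$, where $\hat\alpha>0$ solves $\sum_{i,j}\alpha_{i,j}=1$ and $$\text{(A)}\quad \frac{\alpha_{i,j}}{\alpha_{i',j'}}=\frac{w^c_j\sigma_{i,j}\sum_k\sigma_{i,k}w^c_k/(\mu_b-\mu_i)^2}{w^c_{j'}\sigma_{i',j'}\sum_k\sigma_{i',k}w^c_k/(\mu_b-\mu_{i'})^2}\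 \ (i,i'\ne b),\qquad \text{(T)}\quad\Big(\frac{\alpha_{b,j}}{\sigma_{b,j}}\Big)^2=\sum_{i\ne b}\Big(\frac{\alpha_{i,j}}{\sigma_{i,j}}\Big)^2\ \ (1\le j\le D)$$ with $w^c,\mu,\sigma,b$ replaced by the current $\hat w^{(t)},\hat\mu^{(\ell)},\hat\sigma^{(\ell)},\hat b^{(\ell)}$. *IU-OCBA-balance-UC*: write $\hat b=\hat b^{(\ell)}$ and omit the superscripts $(\ell)$ and $(t)$. If $\min_j\big\{(N_{\hat b,j}/\hat\sigma_{\hat b,j})^2-\sum_{i\neq\hat b}(N_{i,j}/\hat\sigma_{i,j})^2\big\}<0$, then $I=\hat b$; otherwise $$I\in\arg\min_{i\ne\hat b}\ (\hat\mu_{\hat b}-\hat\mu_i)^2\Big/\sum_j\Big(\frac{\hat\sigma_{\hat b,j}^2\hat w_j^2}{N_{\hat b,j}}+\frac{\hat\sigma_{i,j}^2\hat w_j^2}{N_{i,j}}\Big).$$ In both cases $J\in\arg\min_jN_{I,j}/(\hat\sigma_{I,j}\hat w_j)$. **Assumptions.** (1) The input data are i.i.d. with law $F^c$. (2) $N(t)\to\infty$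 and $M(t)\to\infty$. (3) If $M(t)\to\infty$, then $(\hat w^{(t)},\hat\theta^{(t)})\to(w^c,\theta^c)$ almost surely. (4) All $X_i\mid G_{j,\theta}$ have finite fourth moments, and $y^{(k)}_{i,j}$ is continuous on $\Theta$ for $k=1,2,4$. (5) Given all earlier outputs, the pairs chosen so far and the estimates up to the current stage $t$, the output of a simulation of $(i,j)$ is distributed as $X_i\mid G_{j,\hat\theta^{(t)}}$. (6) The laws of $X_i\mid G_{j,\theta}$ have no atoms, and $\mu_1,\dots,\mu_K$ are pairwise distinct. **Proposition.** 1. For IU-OCBA-approx-UC, almost surely $b$ is the selected design (the unique maximizer of $\hat\mu_i$ at the end of stage $t$) for all sufficiently large $t$, and $\hat b^{(\ell)}=b$ for all sufficiently large $\ell$. Moreover there is an $\alpha^*>0$ with $\sum_{i,j}\alpha^*_{i,j}=1$ that satisfies (A) and (T), and almost surely $\alpha^{(\ell)}_{i,j}\to\alpha^*_{i,j}$ for all $i,j$ as $\ell\to\infty$. 2. For IU-OCBA-balance-UC, almost surely $b$ is the selected design for all sufficiently large $t$, and $\hat b^{(\ell)}=b$ for all sufficiently large $\ell$. Moreover, almost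 surely as $\ell\to\infty$, $$\Big|\frac{\alpha^{(\ell)}_{i,j}}{\sigma_{i,j}w^c_j}-\frac{\alpha^{(\ell)}_{i,j'}}{\sigma_{i,j'}w^c_{j'}}\Big|\to0\ \ (i\ne b,\ 1\le j<j'\le D),\qquad\Big|\Big(\frac{\alpha^{(\ell)}_{b,j}}{\sigma_{b,j}}\Big)^2-\sum_{i\ne b}\Big(\frac{\alpha^{(\ell)}_{i,j}}{\sigma_{i,j}}\Big)^2\Big|\to0\ \ (1\le j\le D).$$ -/

import Mathlib

open MeasureTheory ProbabilityTheory Filter Topology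

noncomputable section

namespace IUOCBA

/-- A selection problem with `K` designs whose input distribution is a mixture of `D` components.
Component `j` belongs to the known family `G_{j,θ}`, `θ ∈ Θ`, given by densities `dens j θ` with
respect to a dominating measure `ν`; `θ` may be the vector of the parameters of all components.
`perf i` is the conditional law of the random performance `X_i(ζ)` of design `i` given the input
`ζ`.  `wc` and `θc` are the true (unknown) weights and parameter. -/
structure Model (K D : ℕ) (Ξ Θ : Type*) [MeasurableSpace Ξ] where
  ν : Measure Ξ
  dens : Fin D → Θ → Ξ → ℝ
  dens_measurable : ∀ j θ, Measurable (dens j θ)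
  dens_nonneg : ∀ j θ x, 0 ≤ dens j θ x
  dens_lintegral : ∀ j θ, ∫⁻ x, ENNReal.ofReal (dens j θ x) ∂ν = 1
  perf : Fin K → Kernel Ξ ℝ
  perf_markov : ∀ i, IsMarkovKernel (perf i)
  wc : Fin D → ℝ
  wc_pos : ∀ j, 0 < wc j
  wc_sum : ∑ j, wc j = 1
  θc : Θ

/-- Initial sample size `n0` per design-input pair, data batch sizes `m t` and simulation budgets
`n t` of the stages `t = 1, 2, …` (the values at `t = 0` play no role). -/
structure Schedule where
  n0 : ℕ
  m : ℕ → ℕ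
  n : ℕ → ℕ

namespace Schedule

/-- Total amount of input data collected up to stage `t`. -/
def M (c : Schedule) (t : ℕ) : ℕ := ∑ τ ∈ Finset.Icc 1 t, c.m τ

/-- Total simulation budget of the stages up to `t` (initial samples not counted). -/
def N (c : Schedule) (t : ℕ) : ℕ := ∑ τ ∈ Finset.Icc 1 t, c.n τ

/-- The stage in which the `l`-th simulation after the initialization is run (`l ≥ 1`):
the largest `t` with `N (t - 1) < l`. -/
def stageOf (c : Schedule) (l : ℕ) : ℕ := sSup {t | 1 ≤ t ∧ c.N (t - 1) < l}

/-- Number of initial simulations. -/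
def init (c : Schedule) (K D : ℕ) : ℕ := K * D * c.n0

/-- The stage in which simulation number `r` is run, where all simulations are numbered
`0, 1, 2, …` and the first `init` of them form the initialization, which is stage `0`. -/
def stage (c : Schedule) (K D : ℕ) (r : ℕ) : ℕ :=
  if r < c.init K D then 0 else c.stageOf (r - c.init K D + 1)

end Schedule

namespace Model

variable {K D : ℕ} {Ξ Θ : Type*} [MeasurableSpace Ξ] (S : Model K D Ξ Θ)

/-- The component distribution `G_{j,θ}`. -/
def component (j : Fin D) (θ : Θ) : Measure Ξ :=
  S.ν.withDensity fun x => ENNReal.ofReal (S.dens j θ x)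

/-- The true input distribution, the mixture of the true components with the true weights. -/
def inputLaw : Measure Ξ := ∑ j, ENNReal.ofReal (S.wc j) • S.component j S.θc

/-- The law of `X_i | G_{j,θ}`: draw an input from `G_{j,θ}`, then the performance of design `i`. -/
def outLaw (i : Fin K) (j : Fin D) (θ : Θ) : Measure ℝ := (S.component j θ).bind (S.perf i)

/-- The moment `y_{i,j}^{(k)}(θ) = E[X_i^k | G_{j,θ}]`. -/
def moment (k : ℕ) (i : Fin K) (j : Fin D) (θ : Θ) : ℝ := ∫ x, x ^ k ∂(S.outLaw i j θ)

/-- `μ_{i,j}`, the true mean of the pair `(i, j)`. -/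
def mu (i : Fin K) (j : Fin D) : ℝ := ∫ x, x ∂(S.outLaw i j S.θc)

/-- `σ_{i,j}`, the true standard deviation of the pair `(i, j)`. -/
def sigma (i : Fin K) (j : Fin D) : ℝ := √(Var[id; S.outLaw i j S.θc])

/-- `μ_i`, the expected performance of design `i` under the true input distribution. -/
def perfMean (i : Fin K) : ℝ := ∑ j, S.wc j * S.mu i j

/-- Likelihood of weights `w` and parameter `θ` given the first `k` data points. -/
def likelihood (ξ : ℕ → Ξ) (k : ℕ) (w : Fin D → ℝ) (θ : Θ) : ℝ :=
  ∏ s ∈ Finset.range k, ∑ j, w j * S.dens j θ (ξ s)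

/-- `(w, θ)` is a maximum likelihood estimate given the first `k` data points. -/
def IsMLE (ξ : ℕ → Ξ) (k : ℕ) (w : Fin D → ℝ) (θ : Θ) : Prop :=
  w ∈ stdSimplex ℝ (Fin D) ∧
    ∀ w' ∈ stdSimplex ℝ (Fin D), ∀ θ' : Θ, S.likelihood ξ k w' θ' ≤ S.likelihood ξ k w θ

/-- All moments in use are finite, and the first, second and fourth are continuous on `Θ`. -/
def MomentsContinuous [TopologicalSpace Θ] : Prop :=
  ∀ i j, (∀ θ, MemLp id 4 (S.outLaw i j θ)) ∧
    Continuous (S.moment 1 i j) ∧ Continuous (S.moment 2 i j) ∧ Continuous (S.moment 4 i j)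

end Model

/-- `α` is the positive allocation determined, for weights `w`, means `μ i`, standard deviations
`σ i j` and best design `b`, by the approximate ratio condition between non-best designs,
the total balance condition, and `∑ α = 1`. -/
structure IsApproxAllocation {K D : ℕ} (w : Fin D → ℝ) (μ : Fin K → ℝ) (σ : Fin K → Fin D → ℝ)
    (b : Fin K) (α : Fin K → Fin D → ℝ) : Prop where
  pos : ∀ i j, 0 < α i j
  sum_eq_one : ∑ i, ∑ j, α i j = 1
  ratio : ∀ i i' j j', i ≠ b → i' ≠ b →
    α i j / α i' j' =
      (w j * σ i j * (∑ k, σ i k * w k) / (μ b - μ i) ^ 2) /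
        (w j' * σ i' j' * (∑ k, σ i' k * w k) / (μ b - μ i') ^ 2)
  total_balance : ∀ j, (α b j / σ b j) ^ 2 = ∑ i with i ≠ b, (α i j / σ i j) ^ 2

/-- The random objects of one execution of a sequential procedure with unlimited budget: input
data `ξ s`, estimates `wHat t`, `θHat t` at the stages `t`, the design-input pair `pair r` and the
output `out r` of simulation number `r`, and the estimated best design `bHat r` used to choose
`pair r`.  The estimates at `t = 0` are an initial guess, under which the initial samples are run. -/
structure Execution (K D : ℕ) (Ξ Θ Ω : Type*) where
  ξ : ℕ → Ω → Ξ
  wHat : ℕ → Ω → Fin D → ℝ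
  θHat : ℕ → Ω → Θ
  pair : ℕ → Ω → Fin K × Fin D
  out : ℕ → Ω → ℝ
  bHat : ℕ → Ω → Fin K

namespace Execution

variable {K D : ℕ} {Ξ Θ Ω : Type*} (R : Execution K D Ξ Θ Ω)

/-- `N_{i,j}` before simulation number `r`: how often the pair `(i, j)` has been simulated. -/
def count (r : ℕ) (ω : Ω) (i : Fin K) (j : Fin D) : ℕ :=
  ((Finset.range r).filter fun s => R.pair s ω = (i, j)).card

/-- Sample mean of the outputs of the pair `(i, j)` before simulation number `r`. -/
def muHat (r : ℕ) (ω : Ω) (i : Fin K) (j : Fin D) : ℝ :=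
  (∑ s ∈ Finset.range r with R.pair s ω = (i, j), R.out s ω) / (R.count r ω i j : ℝ)

/-- Sample standard deviation of the outputs of the pair `(i, j)` before simulation `r`. -/
def sigmaHat (r : ℕ) (ω : Ω) (i : Fin K) (j : Fin D) : ℝ :=
  √((∑ s ∈ Finset.range r with R.pair s ω = (i, j), (R.out s ω - R.muHat r ω i j) ^ 2) /
    ((R.count r ω i j : ℝ) - 1))

/-- Estimated performance of design `i` before simulation `r`, with the weights of stage `t`. -/
def perfHat (t r : ℕ) (ω : Ω) (i : Fin K) : ℝ := ∑ j, R.wHat t ω j * R.muHat r ω i j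

/-- Allocation ratio `α_{i,j}^{(l)}` after `l` simulations beyond the initialization. -/
def alpha (c : Schedule) (l : ℕ) (ω : Ω) (i : Fin K) (j : Fin D) : ℝ :=
  (R.count (c.init K D + l) ω i j : ℝ) / ((c.init K D + l : ℕ) : ℝ)

/-- The information available when simulation number `r` is run: all earlier outputs, the pairs
chosen so far (including the current one), and all estimates up to the current stage. -/
@[reducible] def history [MeasurableSpace Θ] (c : Schedule) (r : ℕ) : MeasurableSpace Ω :=
  (⨆ s, ⨆ _ : s < r, MeasurableSpace.comap (R.out s) inferInstance) ⊔
  (⨆ s, ⨆ _ : s ≤ r, MeasurableSpace.comap (R.pair s) inferInstance) ⊔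
  (⨆ t, ⨆ _ : t ≤ c.stage K D r,
    MeasurableSpace.comap (fun ω => (R.wHat t ω, R.θHat t ω)) inferInstance)

/-- All components of the execution are random variables. -/
structure IsMeasurable [MeasurableSpace Ω] [MeasurableSpace Ξ] [MeasurableSpace Θ] : Prop where
  ξ : ∀ s, Measurable (R.ξ s)
  wHat : ∀ t, Measurable (R.wHat t)
  θHat : ∀ t, Measurable (R.θHat t)
  pair : ∀ r, Measurable (R.pair r)
  out : ∀ r, Measurable (R.out r)

/-- The input data are independent and distributed according to the true input distribution. -/
def DataIID [MeasurableSpace Ω] [MeasurableSpace Ξ] (S : Model K D Ξ Θ) (P : Measure Ω) : Prop :=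
  iIndepFun R.ξ P ∧ ∀ s, P.map (R.ξ s) = S.inputLaw

/-- At every stage, weights and parameter are estimated by maximum likelihood from the data
collected so far. -/
def EstimatesAreMLE [MeasurableSpace Ω] [MeasurableSpace Ξ] (S : Model K D Ξ Θ) (c : Schedule)
    (P : Measure Ω) : Prop :=
  ∀ᵐ ω ∂P, ∀ t, S.IsMLE (fun s => R.ξ s ω) (c.M t) (R.wHat t ω) (R.θHat t ω)

/-- Given the information available when simulation `r` is run, its output follows the law of
the performance of the chosen design under the currently estimated chosen component. -/
def SimulatesCurrentEstimate [MeasurableSpace Ω] [MeasurableSpace Ξ] [MeasurableSpace Θ]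
    (S : Model K D Ξ Θ) (c : Schedule) (P : Measure Ω) : Prop :=
  ∀ r, ∀ B : Set ℝ, MeasurableSet B →
    P⟦R.out r ⁻¹' B | R.history c r⟧ =ᵐ[P] fun ω =>
      (S.outLaw (R.pair r ω).1 (R.pair r ω).2 (R.θHat (c.stage K D r) ω)).real B

/-- What the two procedures share: initially every pair is simulated `n0` times, and afterwards
`bHat` is a design with the largest estimated performance (ties are broken in any way). -/
structure Common (c : Schedule) (ω : Ω) : Prop where
  init_count : ∀ i j, R.count (c.init K D) ω i j = c.n0
  bHat_argmax : ∀ r, c.init K D ≤ r → ∀ i,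
    R.perfHat (c.stage K D r) r ω i ≤ R.perfHat (c.stage K D r) r ω (R.bHat r ω)

/-- The estimated weights and standard deviations, by which the procedures divide, are positive
before simulation number `r`. -/
def Regular (c : Schedule) (r : ℕ) (ω : Ω) : Prop :=
  (∀ j, 0 < R.wHat (c.stage K D r) ω j) ∧ ∀ i j, 0 < R.sigmaHat r ω i j

/-- The path follows IU-OCBA-approx-UC: the next pair maximizes `N̂_{i,j} - N_{i,j}`, where
`N̂_{i,j} = α̂_{i,j} (1 + N)` and `α̂` solves the approximate optimality conditions with all
unknowns replaced by their current estimates.  Where that system is undefined (a zero estimate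
in a denominator, or several designs with the largest estimate) the choice is arbitrary. -/
structure FollowsApprox (c : Schedule) (ω : Ω) : Prop extends R.Common c ω where
  select : ∀ r, c.init K D ≤ r → R.Regular c r ω →
    (∀ i, i ≠ R.bHat r ω →
      R.perfHat (c.stage K D r) r ω i < R.perfHat (c.stage K D r) r ω (R.bHat r ω)) →
    ∃ a : Fin K → Fin D → ℝ,
      IsApproxAllocation (R.wHat (c.stage K D r) ω) (R.perfHat (c.stage K D r) r ω)
        (R.sigmaHat r ω) (R.bHat r ω) a ∧
      ∀ i j,
        a i j * (1 + ∑ i', ∑ j', (R.count r ω i' j' : ℝ)) - (R.count r ω i j : ℝ) ≤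
          a (R.pair r ω).1 (R.pair r ω).2 * (1 + ∑ i', ∑ j', (R.count r ω i' j' : ℝ)) -
            (R.count r ω (R.pair r ω).1 (R.pair r ω).2 : ℝ)

/-- Estimated total balance gap of component `j` before simulation number `r`. -/
def gap (r : ℕ) (ω : Ω) (j : Fin D) : ℝ :=
  ((R.count r ω (R.bHat r ω) j : ℝ) / R.sigmaHat r ω (R.bHat r ω) j) ^ 2 -
    ∑ i with i ≠ R.bHat r ω, ((R.count r ω i j : ℝ) / R.sigmaHat r ω i j) ^ 2

/-- Estimated local balance score of design `i` before simulation number `r`. -/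
def score (c : Schedule) (r : ℕ) (ω : Ω) (i : Fin K) : ℝ :=
  (R.perfHat (c.stage K D r) r ω (R.bHat r ω) - R.perfHat (c.stage K D r) r ω i) ^ 2 /
    (∑ j, R.sigmaHat r ω (R.bHat r ω) j ^ 2 * R.wHat (c.stage K D r) ω j ^ 2 /
        (R.count r ω (R.bHat r ω) j : ℝ) +
      ∑ j, R.sigmaHat r ω i j ^ 2 * R.wHat (c.stage K D r) ω j ^ 2 / (R.count r ω i j : ℝ))

/-- The path follows IU-OCBA-balance-UC.  If the smallest estimated total balance gap is negative,
the estimated best design is simulated, otherwise a non-best design with the smallest score; the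
component minimizes `N_{I,j} / (σ̂_{I,j} ŵ_j)` over `j` for the design `I` chosen.  Where a zero
estimate would occur in a denominator the choice is arbitrary. -/
structure FollowsBalance (c : Schedule) (ω : Ω) : Prop extends R.Common c ω where
  design : ∀ r, c.init K D ≤ r → R.Regular c r ω →
    ∃ j₀, (∀ j, R.gap r ω j₀ ≤ R.gap r ω j) ∧
      (R.gap r ω j₀ < 0 → (R.pair r ω).1 = R.bHat r ω) ∧
      (0 ≤ R.gap r ω j₀ → (R.pair r ω).1 ≠ R.bHat r ω ∧
        ∀ i, i ≠ R.bHat r ω → R.score c r ω (R.pair r ω).1 ≤ R.score c r ω i)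
  component : ∀ r, c.init K D ≤ r → R.Regular c r ω → ∀ j,
    (R.count r ω (R.pair r ω).1 (R.pair r ω).2 : ℝ) /
        (R.sigmaHat r ω (R.pair r ω).1 (R.pair r ω).2 *
          R.wHat (c.stage K D r) ω (R.pair r ω).2) ≤
      (R.count r ω (R.pair r ω).1 j : ℝ) /
        (R.sigmaHat r ω (R.pair r ω).1 j * R.wHat (c.stage K D r) ω j)

/-- Along the path, `b` is finally the only design with the largest estimated performance at the
end of a stage, which is the design the procedure reports, and the estimated best design at every
late iteration. -/
def SelectsEventually (c : Schedule) (b : Fin K) (ω : Ω) : Prop :=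
  (∀ᶠ t in atTop, ∀ i, i ≠ b →
    R.perfHat t (c.init K D + c.N t) ω i < R.perfHat t (c.init K D + c.N t) ω b) ∧
  ∀ᶠ l in atTop, R.bHat (c.init K D + l) ω = b

end Execution

end IUOCBA

end

/-! Consistency and sampling are circular: estimates converge to the truth only for pairs simulated
infinitely often, while the sampling depends on the estimates. The circle is broken by showing that
all estimates converge in any case. If a pair is simulated infinitely often, its sample moments
converge to the true ones (`ae_tendsto_moment`): the noise is a martingale difference sequence
sampled at predictable times, and the conditional moments converge because the parameter estimate
does. Otherwise its estimates freeze after finitely many steps (`RegularPath.exists_limits`).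

Absence of atoms makes these provisional limits nondegenerate. Outputs are almost surely distinct,
so frozen standard deviations are positive; and a tie between the limiting performances of two
designs would either be a tie of true means or a nontrivial linear relation among finitely many
outputs with prescribed constant, of which there are only countably many candidates, each null
(`ae_forall_weighted_sum_ne`, `RegularPath.limits_ne`). Hence the provisional limits have a unique
best design. Under convergent estimates with a unique best design either procedure simulates every
pair infinitely often (`FollowsApprox.tendsto_count`, `FollowsBalance.tendsto_count`), so no pair
was frozen and the limits are the true ones (`RegularPath.estimatesConverge`).

The limits of the frequencies are then deterministic consequences of one principle,
`eventually_le_of_increase_le`: a quantity that grows only while below a monotone bound stays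
asymptotically below it. For the approximate rule this bounds each frequency above by its target,
and both sum to one. For the balance rule it is applied to the component ratios within a design, and
in both directions to the squared counts in the total balance condition. -/

noncomputable section

namespace IUOCBA

/-! ### Conditional laws and absence of atoms -/

section ConditionalLaw

variable {Ω β : Type*} {mΩ : MeasurableSpace Ω} {mβ : MeasurableSpace β} {P : Measure Ω}
  [IsProbabilityMeasure P] {X : Ω → β} {Y : Ω → ℝ} {L : Ω → Measure ℝ}

/-- The hypothesis has an exceptional null set for each `B`. The rational half-lines are a countable
generating π-system, so a single null set suffices. -/
lemma condDistrib_ae_eq_of_forall_condExp [∀ ω, IsProbabilityMeasure (L ω)] (hX : Measurable X)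
    (hY : Measurable Y)
    (hL : ∀ B, MeasurableSet B → P⟦Y ⁻¹' B | mβ.comap X⟧ =ᵐ[P] fun ω => (L ω).real B) :
    ∀ᵐ ω ∂P, condDistrib Y X P (X ω) = L ω := by
  have h : ∀ᵐ ω ∂P, ∀ q : ℚ, (condDistrib Y X P (X ω)).real (Set.Iic (q : ℝ)) =
      (L ω).real (Set.Iic (q : ℝ)) := by
    refine ae_all_iff.2 fun q => ?_
    exact (condDistrib_ae_eq_condExp hX hY measurableSet_Iic).trans (hL _ measurableSet_Iic)
  filter_upwards [h] with ω hω
  refine ext_of_generate_finite _ ((BorelSpace.measurable_eq (α := ℝ)).trans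
    Real.borel_eq_generateFrom_Iic_rat) Real.isPiSystem_Iic_rat ?_ (by simp)
  simp only [Set.mem_iUnion, Set.mem_singleton_iff]
  rintro _ ⟨q, rfl⟩
  exact (measureReal_eq_measureReal_iff).1 (hω q)

lemma lintegral_comp_eq_of_condLaw (hX : Measurable X) (hY : Measurable Y)
    (hL : ∀ᵐ ω ∂P, condDistrib Y X P (X ω) = L ω) {f : β × ℝ → ENNReal} (hf : Measurable f) :
    ∫⁻ ω, f (X ω, Y ω) ∂P = ∫⁻ ω, ∫⁻ y, f (X ω, y) ∂(L ω) ∂P := by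
  rw [← lintegral_map hf (hX.prodMk hY), ← compProd_map_condDistrib hY.aemeasurable,
    Measure.lintegral_compProd hf, lintegral_map hf.lintegral_kernel_prod_right' hX]
  exact lintegral_congr_ae (hL.mono fun ω h => by simp [h])

/-- Disintegrate the indicator of the graph of `g`: each inner integral is the mass of one point. -/
lemma ae_ne_of_condLaw (hX : Measurable X) (hY : Measurable Y)
    (hL : ∀ᵐ ω ∂P, condDistrib Y X P (X ω) = L ω) (hatom : ∀ ω x, L ω {x} = 0)
    {g : β → ℝ} (hg : Measurable g) : ∀ᵐ ω ∂P, Y ω ≠ g (X ω) := by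
  have hS : MeasurableSet {p : β × ℝ | p.2 = g p.1} :=
    measurableSet_eq_fun measurable_snd (hg.comp measurable_fst)
  have h := lintegral_comp_eq_of_condLaw hX hY hL
    (f := Set.indicator {p : β × ℝ | p.2 = g p.1} 1)
    (measurable_one.indicator hS)
  have h0 : ∀ ω, ∫⁻ y, Set.indicator {p : β × ℝ | p.2 = g p.1} 1 (X ω, y) ∂(L ω) = 0 := by
    intro ω
    have : (fun y => Set.indicator {p : β × ℝ | p.2 = g p.1} (1 : β × ℝ → ENNReal) (X ω, y)) =
        Set.indicator {g (X ω)} 1 := by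
      ext y; simp [Set.indicator]
    rw [this, lintegral_indicator_one (measurableSet_singleton _), hatom]
  simp only [h0, lintegral_zero] at h
  replace h := (lintegral_eq_zero_iff ((measurable_one.indicator hS).comp (hX.prodMk hY))).1 h
  filter_upwards [h] with ω hω he
  simp [Set.indicator, he] at hω

lemma integrable_comp_of_condLaw (hX : Measurable X) (hY : Measurable Y)
    (hL : ∀ᵐ ω ∂P, condDistrib Y X P (X ω) = L ω) {f : ℝ → ℝ} (hf : Measurable f) {C : ℝ}
    (hint : ∀ ω, Integrable f (L ω)) (hC : ∀ ω, ∫ y, |f y| ∂(L ω) ≤ C) :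
    Integrable (fun ω => f (Y ω)) P := by
  refine ⟨(hf.comp hY).aestronglyMeasurable, ?_⟩
  have h := lintegral_comp_eq_of_condLaw hX hY hL (f := fun p => ‖f p.2‖ₑ)
    (by fun_prop)
  rw [HasFiniteIntegral, h]
  calc _ ≤ ∫⁻ _, ENNReal.ofReal C ∂P := by
        refine lintegral_mono fun ω => ?_
        rw [← ofReal_integral_norm_eq_lintegral_enorm (hint ω)]
        exact ENNReal.ofReal_le_ofReal (hC ω)
    _ < ⊤ := by simp

lemma condExp_comp_eq_of_condLaw (hX : Measurable X) (hY : Measurable Y)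
    (hL : ∀ᵐ ω ∂P, condDistrib Y X P (X ω) = L ω) {f : ℝ → ℝ} (hf : Measurable f)
    (hint : Integrable (fun ω => f (Y ω)) P) :
    P[fun ω => f (Y ω) | mβ.comap X] =ᵐ[P] fun ω => ∫ y, f y ∂(L ω) :=
  (condExp_ae_eq_integral_condDistrib hX hY.aemeasurable hf.stronglyMeasurable hint).trans
    (hL.mono fun ω h => by simp only [h])

end ConditionalLaw

/-! ### Toeplitz and Kronecker lemmas for 0–1 weights -/

section WeightedAverages

lemma tendsto_weighted_average {e z : ℕ → ℝ} {l : ℝ} (he : ∀ n, 0 ≤ e n)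
    (hS : Tendsto (fun n => ∑ s ∈ Finset.range n, e s) atTop atTop)
    (hz : Tendsto z atTop (𝓝 l)) :
    Tendsto (fun n => (∑ s ∈ Finset.range n, e s * z s) / ∑ s ∈ Finset.range n, e s)
      atTop (𝓝 l) := by
  have h1 : (fun n => e n * (z n - l)) =o[atTop] e := by
    have h := ((Asymptotics.isLittleO_one_iff ℝ).2 (tendsto_sub_nhds_zero_iff.2 hz))
    simpa using (Asymptotics.isBigO_refl e atTop).mul_isLittleO h
  have h2 := (h1.sum_range he hS).tendsto_div_nhds_zero
  refine tendsto_sub_nhds_zero_iff.1 (h2.congr' ?_)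
  filter_upwards [hS.eventually_gt_atTop 0] with n hn
  simp only [mul_sub, Finset.sum_sub_distrib, ← Finset.sum_mul]
  field_simp

/-- Kronecker's lemma for averages along the times at which `e` equals one. -/
lemma tendsto_average_zero_of_summable {e x : ℕ → ℝ} {ζ : ℝ} (he : ∀ n, e n = 0 ∨ e n = 1)
    (hS : Tendsto (fun n => ∑ s ∈ Finset.range n, e s) atTop atTop)
    (hz : Tendsto (fun n => ∑ s ∈ Finset.range n,
      e s / ((∑ u ∈ Finset.range s, e u) + 1) * x s) atTop (𝓝 ζ)) :
    Tendsto (fun n => (∑ s ∈ Finset.range n, e s * x s) / ∑ s ∈ Finset.range n, e s)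
      atTop (𝓝 0) := by
  have he0 : ∀ n, 0 ≤ e n := fun n => by rcases he n with h | h <;> simp [h]
  set z : ℕ → ℝ := fun n => ∑ s ∈ Finset.range n,
      e s / ((∑ u ∈ Finset.range s, e u) + 1) * x s with hzdef
  -- Summation by parts: when `e n = 1`, the denominator in the increment of `z` is the partial sum
  -- of `e` up to and including `n`. The average of `e * x` is thus `z` minus a weighted average of
  -- `z`, and both have limit `ζ`.
  have abel : ∀ n, ∑ s ∈ Finset.range n, e s * x s =
      (∑ s ∈ Finset.range n, e s) * z n - ∑ s ∈ Finset.range n, e s * z s := by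
    intro n
    induction n with
    | zero => simp
    | succ n ih =>
      have hpos : 0 ≤ ∑ u ∈ Finset.range n, e u := Finset.sum_nonneg fun s _ => he0 s
      have hzn : z (n + 1) = z n + e n / ((∑ u ∈ Finset.range n, e u) + 1) * x n := by
        simp only [hzdef, Finset.sum_range_succ]
      rw [Finset.sum_range_succ, ih, hzn, Finset.sum_range_succ, Finset.sum_range_succ]
      rcases he n with h | h <;> rw [h] <;> field_simp <;> ring
  have h := hz.sub (tendsto_weighted_average he0 hS hz)
  rw [sub_self] at h
  refine h.congr' ?_
  filter_upwards [hS.eventually_gt_atTop 0] with n hn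
  rw [abel]
  field_simp

lemma sum_sq_div_count_le {e : ℕ → ℝ} (he : ∀ n, e n = 0 ∨ e n = 1) (n : ℕ) :
    ∑ s ∈ Finset.range n, (e s / ((∑ u ∈ Finset.range s, e u) + 1)) ^ 2 ≤ 2 := by
  have he0 : ∀ n, 0 ≤ e n := fun n => by rcases he n with h | h <;> simp [h]
  have hpos : ∀ n, 0 ≤ ∑ u ∈ Finset.range n, e u :=
    fun n => Finset.sum_nonneg fun s _ => he0 s
  -- The nonzero terms are `1 / k ^ 2` for `k = 1, 2, …`; the subtracted tail makes the bound
  -- telescope.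
  have key : ∑ s ∈ Finset.range n, (e s / ((∑ u ∈ Finset.range s, e u) + 1)) ^ 2 ≤
      2 - 2 / ((∑ u ∈ Finset.range n, e u) + 1) := by
    induction n with
    | zero => simp
    | succ n ih =>
      rw [Finset.sum_range_succ, Finset.sum_range_succ _ n]
      have hp := hpos n
      set c := ∑ u ∈ Finset.range n, e u
      rcases he n with h | h
      · rw [h]; simpa using ih
      · rw [h]
        have : (1 / (c + 1)) ^ 2 ≤ 2 / (c + 1) - 2 / (c + 1 + 1) := by
          rw [div_sub_div _ _ (by positivity) (by positivity), div_pow,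
            div_le_div_iff₀ (by positivity) (by positivity)]
          nlinarith [mul_nonneg hp hp, mul_nonneg (mul_nonneg hp hp) hp]
        linarith
  have := hpos n
  have : 0 ≤ 2 / ((∑ u ∈ Finset.range n, e u) + 1) := by positivity
  linarith

end WeightedAverages

/-! ### Strong law at predictable times -/

section MartingaleLaw

variable {Ω : Type*} {mΩ : MeasurableSpace Ω} {P : Measure Ω} [IsProbabilityMeasure P]
  {ℱ : Filtration ℕ mΩ} {e X : ℕ → Ω → ℝ} {C : ℝ}

/-- Convergence of a martingale whose differences are bounded-variance noise weighted by a
predictable sequence with bounded sum of squares. -/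
lemma ae_tendsto_sum_predictable_mul {a : ℕ → Ω → ℝ} {B : ℝ}
    (ha : ∀ n, StronglyMeasurable[ℱ n] (a n)) (ha1 : ∀ n ω, |a n ω| ≤ 1)
    (hB : ∀ n ω, ∑ s ∈ Finset.range n, a s ω ^ 2 ≤ B)
    (hX : ∀ n, StronglyMeasurable[ℱ (n + 1)] (X n)) (hX2 : ∀ n, MemLp (X n) 2 P)
    (hX0 : ∀ n, P[X n | ℱ n] =ᵐ[P] 0)
    (hXC : ∀ n, P[fun ω => X n ω ^ 2 | ℱ n] ≤ᵐ[P] fun _ => C) :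
    ∀ᵐ ω ∂P, ∃ ζ, Tendsto (fun n => ∑ s ∈ Finset.range n, a s ω * X s ω) atTop (𝓝 ζ) := by
  set Z : ℕ → Ω → ℝ := fun n ω => ∑ s ∈ Finset.range n, a s ω * X s ω with hZ
  have haM : ∀ n, StronglyMeasurable (a n) := fun n => (ha n).mono (ℱ.le n)
  have haL : ∀ n, MemLp (a n) ⊤ P := fun n =>
    memLp_top_of_bound (haM n).aestronglyMeasurable 1 (ae_of_all _ (ha1 n))
  have haX : ∀ n, MemLp (fun ω => a n ω * X n ω) 2 P := fun n => (hX2 n).mul (haL n)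
  have hZL : ∀ n, MemLp (Z n) 2 P := fun n => memLp_finsetSum _ fun s _ => haX s
  have hZad : StronglyAdapted ℱ Z := by
    intro n
    have : Z n = ∑ s ∈ Finset.range n, fun ω => a s ω * X s ω := by
      ext ω; simp [hZ]
    rw [this]
    refine Finset.stronglyMeasurable_sum _ fun s hs => ?_
    have hs' := Finset.mem_range.1 hs
    exact ((ha s).mono (ℱ.mono hs'.le)).mul ((hX s).mono (ℱ.mono hs'))
  have hZint : ∀ n, Integrable (Z n) P := fun n => (hZL n).integrable (by norm_num)
  have hXint : ∀ n, Integrable (X n) P := fun n => (hX2 n).integrable (by norm_num)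
  have hdiff : ∀ n, Z (n + 1) - Z n = a n * X n := by
    intro n; ext ω; simp [hZ, Finset.sum_range_succ]
  have hmart : Martingale Z ℱ P := by
    refine martingale_of_condExp_sub_eq_zero_nat hZad hZint fun n => ?_
    rw [hdiff]
    have h := condExp_mul_of_stronglyMeasurable_left (μ := P) (ha n)
      ((haX n).integrable (by norm_num)) (hXint n)
    filter_upwards [h, hX0 n] with ω h1 h2
    rw [h1, Pi.mul_apply, h2]; simp
  -- Orthogonality of increments: `Z n * a n` is known at time `n` and `X n` has conditional mean
  -- zero. So second moments add and `Z` is bounded in `L²`.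
  have hcross : ∀ n, ∫ ω, Z n ω * (a n ω * X n ω) ∂P = 0 := by
    intro n
    have hm : StronglyMeasurable[ℱ n] (Z n * a n) := (hZad n).mul (ha n)
    have hi : Integrable (Z n * a n * X n) P := by
      rw [mul_assoc]; exact (hZL n).integrable_mul (haX n)
    have h := condExp_mul_of_stronglyMeasurable_left (μ := P) hm hi (hXint n)
    have h' : ∫ ω, (Z n * a n * X n) ω ∂P = 0 := by
      rw [← integral_condExp (ℱ.le n), integral_congr_ae (g := fun _ => 0)]
      · simp
      · filter_upwards [h, hX0 n] with ω h1 h2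
        rw [h1, Pi.mul_apply, h2]; simp
    rw [← h']
    exact integral_congr_ae (ae_of_all _ fun ω => by simp [mul_assoc])
  have ha2int : ∀ n, Integrable (fun ω => a n ω ^ 2) P :=
    fun n => (((haL n).mono_exponent le_top : MemLp (a n) 2 P)).integrable_sq
  have hvar : ∀ n, ∫ ω, (a n ω * X n ω) ^ 2 ∂P ≤ C * ∫ ω, a n ω ^ 2 ∂P := by
    intro n
    have hi : Integrable ((fun ω => a n ω ^ 2) * fun ω => X n ω ^ 2) P := by
      refine (haX n).integrable_sq.congr (ae_of_all _ fun ω => ?_)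
      simp [mul_pow]
    have h := condExp_mul_of_stronglyMeasurable_left (μ := P) ((ha n).pow 2) hi
      (hX2 n).integrable_sq
    have h1 : ∫ ω, (a n ω * X n ω) ^ 2 ∂P =
        ∫ ω, ((fun ω => a n ω ^ 2) * fun ω => X n ω ^ 2) ω ∂P :=
      integral_congr_ae (ae_of_all _ fun ω => by simp [mul_pow])
    rw [h1, ← integral_condExp (ℱ.le n), ← integral_const_mul]
    refine integral_mono_ae integrable_condExp ((ha2int n).const_mul C) ?_
    filter_upwards [h, hXC n] with ω h2 h3
    have h2' : (P[(fun ω => a n ω ^ 2) * fun ω => X n ω ^ 2 | ℱ n]) ω =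
      a n ω ^ 2 * (P[fun ω => X n ω ^ 2 | ℱ n]) ω := h2
    rw [h2', mul_comm C]
    exact mul_le_mul_of_nonneg_left h3 (sq_nonneg _)
  have hbound : ∀ n, ∫ ω, Z n ω ^ 2 ∂P ≤ C * ∑ s ∈ Finset.range n, ∫ ω, a s ω ^ 2 ∂P := by
    intro n
    induction n with
    | zero => simp [hZ]
    | succ n ih =>
      have h1 : ∀ ω, Z (n + 1) ω ^ 2 = Z n ω ^ 2 + (2 * (Z n ω * (a n ω * X n ω)) +
          (a n ω * X n ω) ^ 2) := by
        intro ω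
        simp only [hZ, Finset.sum_range_succ]; ring
      have i1 := (hZL n).integrable_sq
      have i2 : Integrable (fun ω => Z n ω * (a n ω * X n ω)) P :=
        (hZL n).integrable_mul (haX n)
      have i3 := (haX n).integrable_sq
      have i4 : Integrable
          (fun ω => 2 * (Z n ω * (a n ω * X n ω)) + (a n ω * X n ω) ^ 2) P :=
        (i2.const_mul 2).add i3
      simp only [h1]
      rw [integral_add i1 i4, integral_add (i2.const_mul 2) i3,
        integral_const_mul, hcross, Finset.sum_range_succ, mul_add]
      linarith [hvar n]
  have hC0 : 0 ≤ C := by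
    have h1 : ∀ᵐ ω ∂P, 0 ≤ C := by
      have h2 : 0 ≤ᵐ[P] P[fun ω => X 0 ω ^ 2 | ℱ 0] :=
        condExp_nonneg (ae_of_all _ fun ω => sq_nonneg (X 0 ω))
      filter_upwards [h2, hXC 0] with ω h3 h4 using le_trans h3 h4
    -- The sign of `C` is forced, since it dominates the conditional expectation of a square on a
    -- probability space.
    exact h1.exists.choose_spec
  have hZ2 : ∀ n, ∫ ω, Z n ω ^ 2 ∂P ≤ C * B := by
    intro n
    refine (hbound n).trans (mul_le_mul_of_nonneg_left ?_ hC0)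
    rw [← integral_finsetSum _ fun s _ => ha2int s]
    calc _ ≤ ∫ _, B ∂P := integral_mono (integrable_finsetSum _ fun s _ => ha2int s)
          (integrable_const _) (hB n)
      _ = B := by simp
  refine hmart.submartingale.exists_ae_tendsto_of_bdd (R := (1 + C * B).toNNReal) fun n => ?_
  rw [eLpNorm_one_eq_lintegral_enorm, ← ofReal_integral_norm_eq_lintegral_enorm (hZint n)]
  refine ENNReal.ofReal_le_ofReal ?_
  -- The convergence theorem asks for an `L¹` bound, obtained from `|z| ≤ 1 + z ^ 2`.
  calc ∫ ω, ‖Z n ω‖ ∂P ≤ ∫ ω, (1 + Z n ω ^ 2) ∂P := by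
        refine integral_mono (hZint n).norm ((integrable_const 1).add (hZL n).integrable_sq) ?_
        intro ω
        simp only [Real.norm_eq_abs]
        nlinarith [sq_abs (Z n ω), sq_nonneg (|Z n ω| - 1), abs_nonneg (Z n ω)]
    _ ≤ 1 + C * B := by
        rw [integral_add (integrable_const 1) (hZL n).integrable_sq]
        simpa using hZ2 n

/-- Strong law of large numbers for martingale differences sampled at predictable times. -/
lemma ae_tendsto_average_of_predictable (he : ∀ n, StronglyMeasurable[ℱ n] (e n))
    (he01 : ∀ n ω, e n ω = 0 ∨ e n ω = 1)
    (hX : ∀ n, StronglyMeasurable[ℱ (n + 1)] (X n)) (hX2 : ∀ n, MemLp (X n) 2 P)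
    (hX0 : ∀ n, P[X n | ℱ n] =ᵐ[P] 0)
    (hXC : ∀ n, P[fun ω => X n ω ^ 2 | ℱ n] ≤ᵐ[P] fun _ => C) :
    ∀ᵐ ω ∂P, Tendsto (fun n => ∑ s ∈ Finset.range n, e s ω) atTop atTop →
      Tendsto (fun n => (∑ s ∈ Finset.range n, e s ω * X s ω) / ∑ s ∈ Finset.range n, e s ω)
        atTop (𝓝 0) := by
  have hpos : ∀ n ω, 0 ≤ ∑ u ∈ Finset.range n, e u ω := fun n ω =>
    Finset.sum_nonneg fun s _ => by rcases he01 s ω with h | h <;> simp [h]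
  -- Dividing by one plus the number of earlier sampling times keeps the weights predictable, with
  -- squares summing to at most 2.
  have h := ae_tendsto_sum_predictable_mul (P := P) (ℱ := ℱ) (C := C) (B := 2)
    (a := fun n ω => e n ω / ((∑ u ∈ Finset.range n, e u ω) + 1)) ?_ ?_ ?_ hX hX2 hX0 hXC
  · filter_upwards [h] with ω hω hS
    obtain ⟨ζ, hζ⟩ := hω
    exact tendsto_average_zero_of_summable (fun n => he01 n ω) hS hζ
  · intro n
    have : StronglyMeasurable[ℱ n] fun ω => ∑ u ∈ Finset.range n, e u ω := by
      have := Finset.stronglyMeasurable_sum (m := ℱ n) (f := e) (Finset.range n)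
        fun s hs => (he s).mono (ℱ.mono (Finset.mem_range.1 hs).le)
      convert this using 2
      simp
    exact ((he n).measurable.div (this.measurable.add_const 1)).stronglyMeasurable
  · intro n ω
    have := hpos n ω
    rcases he01 n ω with h | h
    · simp [h]
    · rw [h, abs_of_nonneg (by positivity), div_le_one (by positivity)]
      linarith
  · exact fun n ω => sum_sq_div_count_le (fun n => he01 n ω) n

end MartingaleLaw

/-! ### Conditioning on a sub-σ-algebra -/

section ConditionalLawGivenSubAlgebra

variable {Ω : Type*} {m mΩ : MeasurableSpace Ω} {P : Measure Ω}
  [IsProbabilityMeasure P] {Y : Ω → ℝ} {L : Ω → Measure ℝ} [∀ ω, IsProbabilityMeasure (L ω)]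

lemma ae_ne_of_condExp (hm : m ≤ mΩ) (hY : Measurable Y)
    (hL : ∀ B, MeasurableSet B → P⟦Y ⁻¹' B | m⟧ =ᵐ[P] fun ω => (L ω).real B)
    (hatom : ∀ ω x, L ω {x} = 0) {g : Ω → ℝ} (hg : Measurable[m] g) :
    ∀ᵐ ω ∂P, Y ω ≠ g ω := by
  -- Conditioning on `m` is conditioning on the identity, viewed as a map from `(Ω, mΩ)` to `(Ω,
  -- m)`.
  have hX : @Measurable Ω Ω mΩ m id := fun s hs => hm s hs
  refine @ae_ne_of_condLaw Ω Ω mΩ m P _ id Y L hX hY ?_ hatom g hg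
  refine @condDistrib_ae_eq_of_forall_condExp Ω Ω mΩ m P _ id Y L _ hX hY ?_
  rwa [MeasurableSpace.comap_id]

lemma integrable_comp_of_condExp (hm : m ≤ mΩ) (hY : Measurable Y)
    (hL : ∀ B, MeasurableSet B → P⟦Y ⁻¹' B | m⟧ =ᵐ[P] fun ω => (L ω).real B)
    {f : ℝ → ℝ} (hf : Measurable f) {C : ℝ}
    (hint : ∀ ω, Integrable f (L ω)) (hC : ∀ ω, ∫ y, |f y| ∂(L ω) ≤ C) :
    Integrable (fun ω => f (Y ω)) P := by
  have hX : @Measurable Ω Ω mΩ m id := fun s hs => hm s hs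
  refine @integrable_comp_of_condLaw Ω Ω mΩ m P _ id Y L hX hY ?_ f hf C hint hC
  refine @condDistrib_ae_eq_of_forall_condExp Ω Ω mΩ m P _ id Y L _ hX hY ?_
  rwa [MeasurableSpace.comap_id]

lemma condExp_comp_eq_integral (hm : m ≤ mΩ) (hY : Measurable Y)
    (hL : ∀ B, MeasurableSet B → P⟦Y ⁻¹' B | m⟧ =ᵐ[P] fun ω => (L ω).real B)
    {f : ℝ → ℝ} (hf : Measurable f) (hint : Integrable (fun ω => f (Y ω)) P) :
    P[fun ω => f (Y ω) | m] =ᵐ[P] fun ω => ∫ y, f y ∂(L ω) := by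
  have hX : @Measurable Ω Ω mΩ m id := fun s hs => hm s hs
  have h := @condExp_comp_eq_of_condLaw Ω Ω mΩ m P _ id Y L hX hY ?_ f hf hint
  · rwa [MeasurableSpace.comap_id] at h
  refine @condDistrib_ae_eq_of_forall_condExp Ω Ω mΩ m P _ id Y L _ hX hY ?_
  rwa [MeasurableSpace.comap_id]

end ConditionalLawGivenSubAlgebra

/-! ### Monotonicity and divergence of the stage index -/

namespace Schedule

variable {c : Schedule}

lemma N_mono (c : Schedule) : Monotone c.N := fun _ _ h =>
  Finset.sum_le_sum_of_subset (Finset.Icc_subset_Icc_right h)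

/-- Needed because `sSup` of an unbounded set of naturals is 0 by default. -/
lemma bddAbove_stageOf (hN : Tendsto c.N atTop atTop) (l : ℕ) :
    BddAbove {t | 1 ≤ t ∧ c.N (t - 1) < l} := by
  obtain ⟨T, hT⟩ := (hN.eventually_ge_atTop l).exists
  refine ⟨T, fun t ht => ?_⟩
  by_contra h
  have := c.N_mono (show T ≤ t - 1 by omega)
  have := ht.2
  omega

lemma le_stageOf (hN : Tendsto c.N atTop atTop) {t l : ℕ} (ht : 1 ≤ t) (h : c.N (t - 1) < l) :
    t ≤ c.stageOf l :=
  le_csSup (bddAbove_stageOf hN l) ⟨ht, h⟩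

lemma stageOf_mono (hN : Tendsto c.N atTop atTop) : Monotone c.stageOf := by
  intro l l' h
  rcases Set.eq_empty_or_nonempty {t | 1 ≤ t ∧ c.N (t - 1) < l} with he | hne
  · simp [stageOf, he]
  · exact csSup_le hne fun t ht => le_stageOf hN ht.1 (ht.2.trans_le h)

lemma stage_mono (hN : Tendsto c.N atTop atTop) (K D : ℕ) : Monotone (c.stage K D) := by
  intro r r' h
  unfold stage
  split_ifs with h1 h2
  · exact le_rfl
  · exact Nat.zero_le _
  · omega
  · exact stageOf_mono hN (by omega)

lemma tendsto_stage (hN : Tendsto c.N atTop atTop) (K D : ℕ) :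
    Tendsto (c.stage K D) atTop atTop := by
  refine tendsto_atTop.2 fun t => ?_
  filter_upwards [eventually_ge_atTop (c.init K D + c.N t + 1)] with r hr
  unfold stage
  rw [if_neg (by omega)]
  refine (Nat.le_succ t).trans (le_stageOf hN (by omega) ?_)
  simp only [Nat.succ_eq_add_one, Nat.add_sub_cancel]
  omega

end Schedule

/-! ### Moments of the output laws -/

namespace Model

variable {K D : ℕ} {Ξ Θ : Type*} [MeasurableSpace Ξ] (S : Model K D Ξ Θ)

instance isProbabilityMeasure_component (j : Fin D) (θ : Θ) :
    IsProbabilityMeasure (S.component j θ) :=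
  ⟨by rw [component, withDensity_apply _ MeasurableSet.univ, Measure.restrict_univ,
    S.dens_lintegral]⟩

instance isProbabilityMeasure_outLaw (i : Fin K) (j : Fin D) (θ : Θ) :
    IsProbabilityMeasure (S.outLaw i j θ) := by
  have := S.perf_markov i
  unfold outLaw
  infer_instance

variable {S}

lemma integrable_pow_outLaw {i : Fin K} {j : Fin D} {θ : Θ} (h : MemLp id 4 (S.outLaw i j θ))
    {k : ℕ} (hk : k ≤ 4) : Integrable (fun x => x ^ k) (S.outLaw i j θ) := by
  have h' : MemLp id (k : ENNReal) (S.outLaw i j θ) := h.mono_exponent (by exact_mod_cast hk)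
  have h2 := h'.integrable_norm_pow'
  exact h2.mono (by fun_prop) (ae_of_all _ fun x => by simp)

lemma sigma_eq {i : Fin K} {j : Fin D} (h : MemLp id 4 (S.outLaw i j S.θc)) :
    S.sigma i j = √(S.moment 2 i j S.θc - S.mu i j ^ 2) := by
  have h2 : MemLp id 2 (S.outLaw i j S.θc) := h.mono_exponent (by norm_num)
  rw [sigma, variance_eq_sub h2]
  rfl

/-- Zero variance would concentrate the law on its mean, which would be an atom. -/
lemma sigma_pos {i : Fin K} {j : Fin D} (h : MemLp id 4 (S.outLaw i j S.θc))
    (hatom : ∀ x, S.outLaw i j S.θc {x} = 0) : 0 < S.sigma i j := by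
  have h2 : MemLp id 2 (S.outLaw i j S.θc) := h.mono_exponent (by norm_num)
  refine Real.sqrt_pos.2 (lt_of_le_of_ne (variance_nonneg _ _) fun h0 => ?_)
  have h1 := ae_eq_integral_of_variance_eq_zero h2 h0.symm
  have h3 : ∀ᵐ x ∂(S.outLaw i j S.θc), x ≠ ∫ x, id x ∂(S.outLaw i j S.θc) :=
    compl_mem_ae_iff.2 (hatom _)
  obtain ⟨x, hx1, hx3⟩ := (h1.and h3).exists
  exact hx3 hx1

/-- Compactness of `Θ` gives a bound valid under every estimated parameter, hence a deterministic
bound on conditional moments. -/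
lemma exists_moment_bound [TopologicalSpace Θ] [CompactSpace Θ] {k : ℕ} (h : ∀ i j, Continuous (S.moment k i j)) :
    ∃ C, ∀ i j θ, |S.moment k i j θ| ≤ C := by
  have h1 : ∀ p : Fin K × Fin D, ∃ C, ∀ θ, |S.moment k p.1 p.2 θ| ≤ C := by
    intro p
    obtain ⟨C, hC⟩ := isCompact_univ.exists_bound_of_continuousOn (h p.1 p.2).continuousOn
    exact ⟨C, fun θ => hC θ trivial⟩
  choose C hC using h1
  refine ⟨∑ p, |C p|, fun i j θ => (hC (i, j) θ).trans ((le_abs_self _).trans ?_)⟩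
  exact Finset.single_le_sum (f := fun p => |C p|) (fun p _ => abs_nonneg _) (Finset.mem_univ _)

lemma mu_eq (i : Fin K) (j : Fin D) : S.mu i j = S.moment 1 i j S.θc := by
  simp [mu, moment]

end Model

namespace Execution

variable {K D : ℕ} {Ξ Θ Ω : Type*} {R : Execution K D Ξ Θ Ω} {c : Schedule}

/-! ### The information before each simulation -/

section Filtration

variable [MeasurableSpace Θ]

lemma measurable_out_history {s r : ℕ} (h : s < r) : Measurable[R.history c r] (R.out s) :=
  (comap_measurable _).mono (le_trans (le_iSup₂_of_le s h le_rfl)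
    (le_sup_left.trans le_sup_left)) le_rfl

lemma measurable_pair_history {s r : ℕ} (h : s ≤ r) : Measurable[R.history c r] (R.pair s) :=
  (comap_measurable _).mono (le_trans (le_iSup₂_of_le s h le_rfl)
    (le_sup_right.trans le_sup_left)) le_rfl

lemma measurable_estimate_history {t r : ℕ} (h : t ≤ c.stage K D r) :
    Measurable[R.history c r] fun ω => (R.wHat t ω, R.θHat t ω) :=
  (comap_measurable _).mono (le_trans (le_iSup₂_of_le t h le_rfl) le_sup_right) le_rfl

/-- The filtration of the information available before each simulation. -/
def historyFiltration [MeasurableSpace Ω] [MeasurableSpace Ξ] (hR : R.IsMeasurable)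
    (hN : Tendsto c.N atTop atTop) : Filtration ℕ (inferInstance : MeasurableSpace Ω) where
  seq := R.history c
  mono' r r' h := by
    refine sup_le (sup_le ?_ ?_) ?_
    · exact iSup₂_le fun s hs => measurable_iff_comap_le.1
        (measurable_out_history (hs.trans_le h))
    · exact iSup₂_le fun s hs => measurable_iff_comap_le.1
        (measurable_pair_history (hs.trans h))
    · exact iSup₂_le fun t ht => measurable_iff_comap_le.1
        (measurable_estimate_history (ht.trans (Schedule.stage_mono hN K D h)))
  le' r := by
    refine sup_le (sup_le ?_ ?_) ?_
    · exact iSup₂_le fun s _ => measurable_iff_comap_le.1 (hR.out s)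
    · exact iSup₂_le fun s _ => measurable_iff_comap_le.1 (hR.pair s)
    · exact iSup₂_le fun t _ => measurable_iff_comap_le.1 ((hR.wHat t).prodMk (hR.θHat t))

end Filtration

lemma ae_out_ne [MeasurableSpace Ξ] [MeasurableSpace Θ] [MeasurableSpace Ω] {P : Measure Ω}
    [IsProbabilityMeasure P] {S : Model K D Ξ Θ} (hR : R.IsMeasurable) (hN : Tendsto c.N atTop atTop)
    (hsim : R.SimulatesCurrentEstimate S c P) (hatom : ∀ i j θ x, S.outLaw i j θ {x} = 0)
    (r : ℕ) {g : Ω → ℝ} (hg : Measurable[R.history c r] g) : ∀ᵐ ω ∂P, R.out r ω ≠ g ω :=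
  ae_ne_of_condExp ((historyFiltration hR hN).le r) (hR.out r) (hsim r)
    (fun _ _ => hatom _ _ _ _) hg

lemma measurable_uncurry_of_measurable {α β γ : Type*} {m : MeasurableSpace γ}
    [MeasurableSpace α] [MeasurableSpace β] {f : α × β → ℝ} (hf : Measurable f) {u : γ → α}
    {v : γ → β} (hu : Measurable u) (hv : Measurable v) : Measurable fun x => f (u x, v x) :=
  hf.comp (hu.prodMk hv)

lemma measurable_moment_history [MeasurableSpace Ξ] [MetricSpace Θ] [MeasurableSpace Θ]
    [BorelSpace Θ] {S : Model K D Ξ Θ} {k : ℕ} (h : ∀ i j, Continuous (S.moment k i j)) (r : ℕ) :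
    Measurable[R.history c r] fun ω =>
      S.moment k (R.pair r ω).1 (R.pair r ω).2 (R.θHat (c.stage K D r) ω) := by
  have h1 : Measurable fun q : (Fin K × Fin D) × Θ => S.moment k q.1.1 q.1.2 q.2 :=
    measurable_from_prod_countable_right fun p => (h p.1 p.2).measurable
  have h2 : Measurable[R.history c r] fun ω => (R.wHat (c.stage K D r) ω,
    R.θHat (c.stage K D r) ω) := measurable_estimate_history le_rfl
  have h3 : Measurable[R.history c r] fun ω => R.θHat (c.stage K D r) ω :=
    measurable_snd.comp h2
  exact measurable_uncurry_of_measurable h1 (measurable_pair_history le_rfl) h3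

/-! ### Consistency of sample moments -/

section LawOfLargeNumbers

variable [MeasurableSpace Ξ] [MetricSpace Θ] [CompactSpace Θ] [MeasurableSpace Θ] [BorelSpace Θ]
  [MeasurableSpace Ω] {P : Measure Ω} [IsProbabilityMeasure P] {S : Model K D Ξ Θ}

/-- Split each power of an output into its conditional moment and noise. The noise averages to zero
by the martingale law; the conditional moments converge by continuity, since the stage tends to
infinity. Moments of order `2 * k` bound the conditional variance of the noise, so `k = 2` uses the
fourth moment. -/
lemma ae_tendsto_moment (hR : R.IsMeasurable) (hN : Tendsto c.N atTop atTop)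
    (hsim : R.SimulatesCurrentEstimate S c P)
    (hθ : ∀ᵐ ω ∂P, Tendsto (fun t => R.θHat t ω) atTop (𝓝 S.θc))
    (hL : ∀ i j θ, MemLp id 4 (S.outLaw i j θ)) {k : ℕ} (hk : 2 * k ≤ 4)
    (hk1 : ∀ i j, Continuous (S.moment k i j)) (hk2 : ∀ i j, Continuous (S.moment (2 * k) i j))
    (i : Fin K) (j : Fin D) :
    ∀ᵐ ω ∂P, Tendsto (fun r => (R.count r ω i j : ℝ)) atTop atTop →
      Tendsto (fun r => (∑ s ∈ Finset.range r with R.pair s ω = (i, j), R.out s ω ^ k) /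
        (R.count r ω i j : ℝ)) atTop (𝓝 (S.moment k i j S.θc)) := by
  set ℱ := historyFiltration hR hN
  obtain ⟨C1, hC1⟩ := Model.exists_moment_bound hk1
  obtain ⟨C2, hC2⟩ := Model.exists_moment_bound hk2
  set y : ℕ → Ω → ℝ := fun r ω =>
    S.moment k (R.pair r ω).1 (R.pair r ω).2 (R.θHat (c.stage K D r) ω) with hy
  have hym : ∀ r, StronglyMeasurable[ℱ r] (y r) := fun r =>
    (measurable_moment_history hk1 r).stronglyMeasurable
  have hyM : ∀ r, Measurable (y r) := fun r => ((hym r).mono (ℱ.le r)).measurable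
  have hyL : ∀ r, MemLp (y r) 2 P := fun r =>
    (memLp_top_of_bound (hyM r).aestronglyMeasurable C1
      (ae_of_all _ fun ω => hC1 _ _ _)).mono_exponent le_top
  have hyint : ∀ r, Integrable (y r) P := fun r => (hyL r).integrable (by norm_num)
  have hint2 : ∀ r, Integrable (fun ω => R.out r ω ^ (2 * k)) P := by
    intro r
    refine integrable_comp_of_condExp (ℱ.le r) (hR.out r) (hsim r) (f := fun x => x ^ (2 * k))
      (by fun_prop) (C := C2) (fun ω => Model.integrable_pow_outLaw (hL _ _ _) hk) fun ω => ?_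
    have h1 : ∀ x : ℝ, |x ^ (2 * k)| = x ^ (2 * k) := fun x => by
      rw [abs_of_nonneg]; rw [pow_mul]; positivity
    simp only [h1]
    exact (le_abs_self _).trans (hC2 _ _ _)
  have houtL : ∀ r, MemLp (fun ω => R.out r ω ^ k) 2 P := by
    intro r
    refine (memLp_two_iff_integrable_sq ((hR.out r).pow_const k).aestronglyMeasurable).2 ?_
    refine (hint2 r).congr (ae_of_all _ fun ω => ?_)
    simp only
    rw [← pow_mul, mul_comm]
  have houtint : ∀ r, Integrable (fun ω => R.out r ω ^ k) P :=
    fun r => (houtL r).integrable (by norm_num)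
  have hcond1 : ∀ r, P[fun ω => R.out r ω ^ k | ℱ r] =ᵐ[P] y r := fun r =>
    condExp_comp_eq_integral (ℱ.le r) (hR.out r) (hsim r) (f := fun x => x ^ k) (by fun_prop)
      (houtint r)
  have hcond2 : ∀ r, P[fun ω => R.out r ω ^ (2 * k) | ℱ r] =ᵐ[P] fun ω =>
      S.moment (2 * k) (R.pair r ω).1 (R.pair r ω).2 (R.θHat (c.stage K D r) ω) := fun r =>
    condExp_comp_eq_integral (ℱ.le r) (hR.out r) (hsim r) (f := fun x => x ^ (2 * k))
      (by fun_prop) (hint2 r)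
  set e : ℕ → Ω → ℝ := fun s ω => if R.pair s ω = (i, j) then 1 else 0 with he
  -- The constant comes from `(u - v) ^ 2 ≤ 2 * u ^ 2 + 2 * v ^ 2`.
  have key := ae_tendsto_average_of_predictable (P := P) (ℱ := ℱ) (e := e)
    (X := fun r ω => R.out r ω ^ k - y r ω) (C := 2 * C2 + 2 * C1 ^ 2) ?_ ?_ ?_ ?_ ?_ ?_
  · filter_upwards [key, hθ] with ω h1 h2 hcount
    have hc : ∀ r, ∑ s ∈ Finset.range r, e s ω = (R.count r ω i j : ℝ) := by
      intro r
      simp [he, count]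
    have hsum : ∀ (r : ℕ) (f : ℕ → ℝ), ∑ s ∈ Finset.range r with R.pair s ω = (i, j), f s =
        ∑ s ∈ Finset.range r, e s ω * f s := by
      intro r f
      rw [Finset.sum_filter]
      exact Finset.sum_congr rfl fun s _ => by simp [he]
    simp only [← hc] at hcount ⊢
    have h3 := h1 hcount
    have h4 : Tendsto (fun r => S.moment k i j (R.θHat (c.stage K D r) ω)) atTop
        (𝓝 (S.moment k i j S.θc)) :=
      ((hk1 i j).tendsto _).comp (h2.comp (Schedule.tendsto_stage hN K D))
    have h5 := tendsto_weighted_average (e := fun s => e s ω)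
      (fun s => by simp only [he]; split_ifs <;> norm_num) hcount h4
    have h6 := h3.add h5
    rw [zero_add] at h6
    refine h6.congr fun r => ?_
    rw [hsum, ← add_div, ← Finset.sum_add_distrib]
    congr 1
    refine Finset.sum_congr rfl fun s _ => ?_
    simp only [he, hy]
    split_ifs with hs
    · rw [hs]; ring
    · ring
  · intro r
    refine Measurable.stronglyMeasurable (Measurable.ite ?_ measurable_const measurable_const)
    exact measurable_pair_history le_rfl (measurableSet_singleton (i, j))
  · intro r ω
    simp only [he]; split_ifs <;> simp
  · intro r
    have h1 : Measurable[ℱ (r + 1)] (R.out r) := measurable_out_history (Nat.lt_succ_self r)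
    exact (h1.pow_const k).stronglyMeasurable.sub ((hym r).mono (ℱ.mono (Nat.le_succ r)))
  · exact fun r => (houtL r).sub (hyL r)
  · intro r
    have h1 := condExp_sub (houtint r) (hyint r) (ℱ r)
    rw [condExp_of_stronglyMeasurable (ℱ.le r) (hym r) (hyint r)] at h1
    filter_upwards [h1, hcond1 r] with ω h2 h3
    have h2' : (P[fun ω => R.out r ω ^ k - y r ω | ℱ r]) ω =
      (P[fun ω => R.out r ω ^ k | ℱ r]) ω - y r ω := h2
    rw [h2', h3]; simp
  · intro r
    have hle : (fun ω => (R.out r ω ^ k - y r ω) ^ 2) ≤ᵐ[P]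
        (fun ω => R.out r ω ^ (2 * k) + R.out r ω ^ (2 * k)) + fun _ => 2 * C1 ^ 2 := by
      refine ae_of_all _ fun ω => ?_
      have h1 : y r ω ^ 2 ≤ C1 ^ 2 := sq_le_sq' (abs_le.1 (hC1 _ _ _)).1 (abs_le.1 (hC1 _ _ _)).2
      have h2 : R.out r ω ^ (2 * k) = (R.out r ω ^ k) ^ 2 := by rw [← pow_mul, mul_comm]
      simp only [Pi.add_apply, h2]
      nlinarith [sq_nonneg (R.out r ω ^ k + y r ω)]
    have h1 := condExp_mono (m := ℱ r) ((houtL r).sub (hyL r)).integrable_sq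
      (((hint2 r).add (hint2 r)).add (integrable_const (2 * C1 ^ 2))) hle
    have h2 := condExp_add ((hint2 r).add (hint2 r)) (integrable_const (2 * C1 ^ 2)) (ℱ r)
    have h3 := condExp_add (hint2 r) (hint2 r) (ℱ r)
    rw [condExp_const (ℱ.le r)] at h2
    filter_upwards [h1, h2, h3, hcond2 r] with ω g1 g2 g3 g4
    refine g1.trans (g2.le.trans ?_)
    rw [Pi.add_apply, g3, Pi.add_apply, g4]
    have := (le_abs_self _).trans
      (hC2 (R.pair r ω).1 (R.pair r ω).2 (R.θHat (c.stage K D r) ω))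
    linarith

end LawOfLargeNumbers

end Execution

/-- If a sequence only increases when it ends up below a monotone bound, then it stays below this
bound, up to an error of smaller order. -/
lemma eventually_le_of_increase_le {x y g : ℕ → ℝ} (hy : Monotone y) (hg : Monotone g)
    (hgt : Tendsto g atTop atTop)
    (h : ∀ ε > 0, ∀ᶠ r in atTop, x r < x (r + 1) → x (r + 1) ≤ y r + ε * g r)
    {ε : ℝ} (hε : 0 < ε) : ∀ᶠ r in atTop, x r ≤ y r + ε * g r := by
  obtain ⟨r₀, hr₀⟩ := eventually_atTop.1 (h (ε / 2) (half_pos hε))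
  -- The excess at the starting time is never enlarged, and the other half of `ε * g` eventually
  -- absorbs it.
  set C : ℝ := max 0 (x r₀ - (y r₀ + ε / 2 * g r₀))
  have hC : 0 ≤ C := le_max_left _ _
  have key : ∀ r ≥ r₀, x r ≤ y r + ε / 2 * g r + C := by
    intro r hr
    induction r, hr using Nat.le_induction with
    | base => have := le_max_right 0 (x r₀ - (y r₀ + ε / 2 * g r₀)); linarith
    | succ r hr ih =>
      have h1 := hy (Nat.le_succ r)
      have h2 := mul_le_mul_of_nonneg_left (hg (Nat.le_succ r)) (half_pos hε).le
      simp only [Nat.succ_eq_add_one] at h1 h2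
      by_cases hx : x r < x (r + 1)
      · linarith [hr₀ r hr hx]
      · linarith
  filter_upwards [eventually_ge_atTop r₀, hgt.eventually_ge_atTop (C / (ε / 2))] with r h1 h2
  have h3 := (div_le_iff₀ (half_pos hε)).1 h2
  linarith [key r h1]

/-! ### The explicit solution of (A) and (T) -/

section Allocation

variable {K D : ℕ}

/-- Unnormalized allocation to a design `i` that is not the best one. -/
def ratioWeight (w : Fin D → ℝ) (μ : Fin K → ℝ) (σ : Fin K → Fin D → ℝ) (b : Fin K)
    (i : Fin K) (j : Fin D) : ℝ :=
  w j * σ i j * (∑ k, σ i k * w k) / (μ b - μ i) ^ 2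

/-- Unnormalized solution of the approximate ratio condition and the total balance condition. -/
def approxWeight (w : Fin D → ℝ) (μ : Fin K → ℝ) (σ : Fin K → Fin D → ℝ) (b : Fin K)
    (i : Fin K) (j : Fin D) : ℝ :=
  if i = b then σ b j * √(∑ i' with i' ≠ b, (ratioWeight w μ σ b i' j / σ i' j) ^ 2)
  else ratioWeight w μ σ b i j

/-- The solution of the approximate ratio condition and the total balance condition. -/
def approxAlloc (w : Fin D → ℝ) (μ : Fin K → ℝ) (σ : Fin K → Fin D → ℝ) (b : Fin K)
    (i : Fin K) (j : Fin D) : ℝ :=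
  approxWeight w μ σ b i j / ∑ i', ∑ j', approxWeight w μ σ b i' j'

variable {w : Fin D → ℝ} {μ : Fin K → ℝ} {σ : Fin K → Fin D → ℝ} {b : Fin K}

lemma ratioWeight_pos (hw : ∀ j, 0 < w j) (hσ : ∀ i j, 0 < σ i j) {i : Fin K} (hμ : μ i < μ b)
    (j : Fin D) : 0 < ratioWeight w μ σ b i j := by
  have h1 : 0 < ∑ k, σ i k * w k :=
    Finset.sum_pos (fun k _ => mul_pos (hσ i k) (hw k)) ⟨j, Finset.mem_univ j⟩
  have h2 : 0 < μ b - μ i := sub_pos.2 hμ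
  have := hw j
  have := hσ i j
  unfold ratioWeight
  positivity

lemma exists_ne_of_two_le (hK : 2 ≤ K) (b : Fin K) : ∃ i, i ≠ b := by
  have : Nontrivial (Fin K) := Fin.nontrivial_iff_two_le.2 hK
  exact exists_ne b

lemma approxWeight_pos (hK : 2 ≤ K) (hw : ∀ j, 0 < w j) (hσ : ∀ i j, 0 < σ i j)
    (hμ : ∀ i, i ≠ b → μ i < μ b) (i : Fin K) (j : Fin D) : 0 < approxWeight w μ σ b i j := by
  unfold approxWeight
  split_ifs with h
  · obtain ⟨i', hi'⟩ := exists_ne_of_two_le hK b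
    refine mul_pos (hσ b j) (Real.sqrt_pos.2 (Finset.sum_pos (fun k hk => ?_) ⟨i', by simpa⟩))
    have h1 := ratioWeight_pos hw hσ (hμ k (by simpa using hk)) j
    have h2 := hσ k j
    positivity
  · exact ratioWeight_pos hw hσ (hμ i h) j

lemma sum_approxWeight_pos (hK : 2 ≤ K) (hw : ∀ j, 0 < w j) (hσ : ∀ i j, 0 < σ i j)
    (hμ : ∀ i, i ≠ b → μ i < μ b) (hD : 0 < D) : 0 < ∑ i, ∑ j, approxWeight w μ σ b i j :=
  Finset.sum_pos (fun i _ => Finset.sum_pos (fun j _ => approxWeight_pos hK hw hσ hμ i j)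
    ⟨⟨0, hD⟩, Finset.mem_univ _⟩) ⟨b, Finset.mem_univ _⟩

lemma isApproxAllocation_approxAlloc (hK : 2 ≤ K) (hw : ∀ j, 0 < w j) (hσ : ∀ i j, 0 < σ i j)
    (hμ : ∀ i, i ≠ b → μ i < μ b) (hD : 0 < D) :
    IsApproxAllocation w μ σ b (approxAlloc w μ σ b) := by
  have hs := sum_approxWeight_pos hK hw hσ hμ hD
  constructor
  · exact fun i j => div_pos (approxWeight_pos hK hw hσ hμ i j) hs
  · simp only [approxAlloc, ← Finset.sum_div]
    exact div_self hs.ne'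
  · intro i i' j j' hi hi'
    rw [approxAlloc, approxAlloc, div_div_div_cancel_right₀ hs.ne']
    simp only [approxWeight, if_neg hi, if_neg hi', ratioWeight]
  · intro j
    have h1 : ∀ i ∈ Finset.univ.filter (fun i => i ≠ b), (approxAlloc w μ σ b i j / σ i j) ^ 2 =
        (ratioWeight w μ σ b i j / σ i j) ^ 2 / (∑ i', ∑ j', approxWeight w μ σ b i' j') ^ 2 := by
      intro i hi
      have hi : i ≠ b := by simpa using hi
      simp only [approxAlloc, approxWeight, if_neg hi]
      ring
    rw [Finset.sum_congr rfl h1, ← Finset.sum_div, approxAlloc]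
    have h2 : approxWeight w μ σ b b j =
        σ b j * √(∑ i' with i' ≠ b, (ratioWeight w μ σ b i' j / σ i' j) ^ 2) := by
      simp [approxWeight]
    rw [h2, div_div, mul_comm _ (σ b j), mul_div_mul_left _ _ (hσ b j).ne', div_pow,
      Real.sq_sqrt (Finset.sum_nonneg fun _ _ => sq_nonneg _)]

/-- The ratio condition fixes the non-best rows up to a factor `t`, total balance with positivity
fixes the best row, and normalization fixes `t`. Uniqueness identifies whatever solution the
procedure computes with the explicit, continuous formula. -/
lemma IsApproxAllocation.eq_approxAlloc (hK : 2 ≤ K) (hw : ∀ j, 0 < w j) (hσ : ∀ i j, 0 < σ i j)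
    (hμ : ∀ i, i ≠ b → μ i < μ b) (hD : 0 < D) {α : Fin K → Fin D → ℝ}
    (h : IsApproxAllocation w μ σ b α) : α = approxAlloc w μ σ b := by
  have hs := sum_approxWeight_pos hK hw hσ hμ hD
  obtain ⟨i₀, hi₀⟩ := exists_ne_of_two_le hK b
  set j₀ : Fin D := ⟨0, hD⟩
  have hr0 := ratioWeight_pos hw hσ (hμ i₀ hi₀) j₀
  have ha0 := h.pos i₀ j₀
  set t := α i₀ j₀ / ratioWeight w μ σ b i₀ j₀ with ht
  have htpos : 0 < t := div_pos ha0 hr0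
  have h1 : ∀ i, i ≠ b → ∀ j, α i j = t * ratioWeight w μ σ b i j := by
    intro i hi j
    have h2 : α i j / α i₀ j₀ = ratioWeight w μ σ b i j / ratioWeight w μ σ b i₀ j₀ :=
      h.ratio i i₀ j j₀ hi hi₀
    rw [div_eq_iff ha0.ne'] at h2
    rw [h2, ht]; ring
  have h3 : ∀ i j, α i j = t * approxWeight w μ σ b i j := by
    intro i j
    by_cases hi : i = b
    · subst hi
      have h4 := h.total_balance j
      have h5 : ∑ i' with i' ≠ i, (α i' j / σ i' j) ^ 2 =
          t ^ 2 * ∑ i' with i' ≠ i, (ratioWeight w μ σ i i' j / σ i' j) ^ 2 := by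
        rw [Finset.mul_sum]
        refine Finset.sum_congr rfl fun k hk => ?_
        rw [h1 k (by simpa using hk)]; ring
      have h6 : α i j / σ i j =
          t * √(∑ i' with i' ≠ i, (ratioWeight w μ σ i i' j / σ i' j) ^ 2) := by
        rw [← Real.sqrt_sq (div_pos (h.pos i j) (hσ i j)).le, h4, h5,
          Real.sqrt_mul (sq_nonneg t), Real.sqrt_sq htpos.le]
      rw [div_eq_iff (hσ i j).ne'] at h6
      rw [h6]
      simp only [approxWeight, if_true]
      ring
    · rw [h1 i hi]; simp [approxWeight, hi]
  have h7 : t * ∑ i, ∑ j, approxWeight w μ σ b i j = 1 := by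
    rw [← h.sum_eq_one, Finset.mul_sum]
    refine Finset.sum_congr rfl fun i _ => ?_
    rw [Finset.mul_sum]
    exact Finset.sum_congr rfl fun j _ => (h3 i j).symm
  ext i j
  rw [h3, approxAlloc, eq_div_iff hs.ne', mul_right_comm, h7, one_mul]

lemma tendsto_approxAlloc {ι : Type*} {l : Filter ι} {w' : ι → Fin D → ℝ} {μ' : ι → Fin K → ℝ}
    {σ' : ι → Fin K → Fin D → ℝ} (hK : 2 ≤ K) (hw : ∀ j, 0 < w j) (hσ : ∀ i j, 0 < σ i j)
    (hμ : ∀ i, i ≠ b → μ i < μ b) (hD : 0 < D)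
    (hw' : ∀ j, Tendsto (fun n => w' n j) l (𝓝 (w j)))
    (hμ' : ∀ i, Tendsto (fun n => μ' n i) l (𝓝 (μ i)))
    (hσ' : ∀ i j, Tendsto (fun n => σ' n i j) l (𝓝 (σ i j))) (i : Fin K) (j : Fin D) :
    Tendsto (fun n => approxAlloc (w' n) (μ' n) (σ' n) b i j) l (𝓝 (approxAlloc w μ σ b i j)) := by
  have h1 : ∀ i, i ≠ b → ∀ j, Tendsto (fun n => ratioWeight (w' n) (μ' n) (σ' n) b i j) l
      (𝓝 (ratioWeight w μ σ b i j)) := by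
    intro i hi j
    refine ((((hw' j).mul (hσ' i j)).mul (tendsto_finsetSum _ fun k _ =>
      (hσ' i k).mul (hw' k))).div (((hμ' b).sub (hμ' i)).pow 2) ?_)
    exact pow_ne_zero _ (sub_pos.2 (hμ i hi)).ne'
  have h2 : ∀ i j, Tendsto (fun n => approxWeight (w' n) (μ' n) (σ' n) b i j) l
      (𝓝 (approxWeight w μ σ b i j)) := by
    intro i j
    unfold approxWeight
    split_ifs with hi
    · refine (hσ' b j).mul (Tendsto.sqrt (tendsto_finsetSum _ fun k hk => ?_))
      exact ((h1 k (by simpa using hk) j).div (hσ' k j) (hσ k j).ne').pow 2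
    · exact h1 i hi j
  exact (h2 i j).div (tendsto_finsetSum _ fun i _ => tendsto_finsetSum _ fun j _ => h2 i j)
    (sum_approxWeight_pos hK hw hσ hμ hD).ne'

end Allocation

namespace Execution

variable {K D : ℕ} {Ξ Θ Ω : Type*} {R : Execution K D Ξ Θ Ω} {c : Schedule} {ω : Ω}

/-! ### Simulation counts -/

section Count

lemma count_succ (r : ℕ) (ω : Ω) (i : Fin K) (j : Fin D) :
    R.count (r + 1) ω i j = R.count r ω i j + if R.pair r ω = (i, j) then 1 else 0 := by
  simp only [count, Finset.range_add_one, Finset.filter_insert]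
  split_ifs with h
  · rw [Finset.card_insert_of_notMem (by simp)]
  · rfl

lemma count_mono (ω : Ω) (i : Fin K) (j : Fin D) : Monotone fun r => R.count r ω i j :=
  monotone_nat_of_le_succ fun r => by rw [count_succ]; omega

lemma sum_count (r : ℕ) (ω : Ω) : ∑ i, ∑ j, R.count r ω i j = r := by
  rw [← Fintype.sum_prod_type' (f := fun i j => R.count r ω i j)]
  have := Finset.card_eq_sum_card_fiberwise (f := fun s => R.pair s ω) (s := Finset.range r)
    (t := Finset.univ) (fun _ _ => Finset.mem_univ _)
  rw [Finset.card_range] at this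
  exact this.symm

lemma count_le (r : ℕ) (ω : Ω) (i : Fin K) (j : Fin D) : R.count r ω i j ≤ r :=
  (Finset.card_filter_le _ _).trans_eq (Finset.card_range r)

lemma pair_eq_of_count_lt {r : ℕ} {i : Fin K} {j : Fin D}
    (h : R.count r ω i j < R.count (r + 1) ω i j) : R.pair r ω = (i, j) := by
  rw [count_succ] at h
  by_contra hne
  simp [hne] at h

lemma count_succ_le (r : ℕ) (ω : Ω) (i : Fin K) (j : Fin D) :
    R.count (r + 1) ω i j ≤ R.count r ω i j + 1 := by
  rw [count_succ]; split_ifs <;> omega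

end Count

end Execution

namespace Execution

variable {K D : ℕ} {Ξ Θ Ω : Type*} {R : Execution K D Ξ Θ Ω} {c : Schedule} {ω : Ω}

lemma tendsto_count_of_frequently {i : Fin K} {j : Fin D}
    (h : ∃ᶠ r in atTop, R.pair r ω = (i, j)) :
    Tendsto (fun r => R.count r ω i j) atTop atTop := by
  refine tendsto_atTop_atTop_of_monotone (count_mono ω i j) fun n => ?_
  induction n with
  | zero => exact ⟨0, Nat.zero_le _⟩
  | succ n ih =>
    obtain ⟨r, hr⟩ := ih
    obtain ⟨r', hr', hp⟩ := frequently_atTop.1 h r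
    refine ⟨r' + 1, ?_⟩
    rw [count_succ, if_pos hp]
    exact Nat.succ_le_succ (hr.trans (count_mono ω i j hr'))

lemma count_eq_of_pair_ne {i : Fin K} {j : Fin D} {r₀ : ℕ}
    (h : ∀ r ≥ r₀, R.pair r ω ≠ (i, j)) {r : ℕ} (hr : r₀ ≤ r) :
    R.count r ω i j = R.count r₀ ω i j := by
  induction r, hr using Nat.le_induction with
  | base => rfl
  | succ r hr ih => rw [count_succ, if_neg (h r hr), ih, add_zero]

lemma tendsto_count_of_not_frequently {i : Fin K} {j : Fin D}
    (h : ¬ ∃ᶠ r in atTop, R.pair r ω = (i, j)) :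
    ∃ n : ℕ, ∀ᶠ r in atTop, R.count r ω i j = n := by
  obtain ⟨r₀, hr₀⟩ := eventually_atTop.1 (not_frequently.1 h)
  exact ⟨_, eventually_atTop.2 ⟨r₀, fun r hr => count_eq_of_pair_ne hr₀ hr⟩⟩

/-- Along the path, all estimates converge, and weights and standard deviations do so to positive
limits. -/
structure EstimatesConverge (R : Execution K D Ξ Θ Ω) (c : Schedule) (ω : Ω) (w : Fin D → ℝ)
    (μ : Fin K → ℝ) (σ : Fin K → Fin D → ℝ) : Prop where
  w_pos : ∀ j, 0 < w j
  σ_pos : ∀ i j, 0 < σ i j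
  wHat : ∀ j, Tendsto (fun r => R.wHat (c.stage K D r) ω j) atTop (𝓝 (w j))
  perfHat : ∀ i, Tendsto (fun r => R.perfHat (c.stage K D r) r ω i) atTop (𝓝 (μ i))
  sigmaHat : ∀ i j, Tendsto (fun r => R.sigmaHat r ω i j) atTop (𝓝 (σ i j))

variable {w : Fin D → ℝ} {μ : Fin K → ℝ} {σ : Fin K → Fin D → ℝ} {b : Fin K}

lemma EstimatesConverge.eventually_regular (h : R.EstimatesConverge c ω w μ σ) :
    ∀ᶠ r in atTop, R.Regular c r ω := by
  have h1 : ∀ᶠ r in atTop, ∀ j, 0 < R.wHat (c.stage K D r) ω j :=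
    eventually_all.2 fun j => (h.wHat j).eventually (eventually_gt_nhds (h.w_pos j))
  have h2 : ∀ᶠ r in atTop, ∀ i j, 0 < R.sigmaHat r ω i j :=
    eventually_all.2 fun i => eventually_all.2 fun j =>
      (h.sigmaHat i j).eventually (eventually_gt_nhds (h.σ_pos i j))
  filter_upwards [h1, h2] with r h1 h2 using ⟨h1, h2⟩

lemma EstimatesConverge.eventually_perfHat_lt (h : R.EstimatesConverge c ω w μ σ)
    (hμ : ∀ i, i ≠ b → μ i < μ b) : ∀ᶠ r in atTop, ∀ i, i ≠ b →
      R.perfHat (c.stage K D r) r ω i < R.perfHat (c.stage K D r) r ω b := by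
  refine eventually_all.2 fun i => ?_
  by_cases hi : i = b
  · simp [hi]
  · filter_upwards [(h.perfHat i).eventually_lt (h.perfHat b) (hμ i hi)] with r hr _ using hr

lemma EstimatesConverge.eventually_bHat_eq (h : R.EstimatesConverge c ω w μ σ)
    (hC : R.Common c ω) (hμ : ∀ i, i ≠ b → μ i < μ b) : ∀ᶠ r in atTop, R.bHat r ω = b := by
  filter_upwards [h.eventually_perfHat_lt hμ, eventually_ge_atTop (c.init K D)] with r h1 h2
  by_contra hne
  exact absurd (hC.bHat_argmax r h2 b) (not_le.2 (h1 _ hne))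

/-! ### The approximate rule -/

section Approx

/-- Frequencies that are asymptotically bounded above by the terms of a probability vector
converge to it. -/
lemma tendsto_of_eventually_le_of_sum_eq_one {ι : Type*} [Fintype ι] {u : ℕ → ι → ℝ} {α : ι → ℝ}
    (hu : ∀ᶠ r in atTop, ∑ p, u r p = 1) (hα : ∑ p, α p = 1)
    (hle : ∀ p, ∀ ε > 0, ∀ᶠ r in atTop, u r p ≤ α p + ε) (p : ι) :
    Tendsto (fun r => u r p) atTop (𝓝 (α p)) := by
  rw [Metric.tendsto_nhds]
  intro ε hε
  set n : ℝ := (Fintype.card ι : ℝ)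
  have hn : 0 < n + 1 := by positivity
  filter_upwards [hu, eventually_all.2 fun q => hle q (ε / (n + 1)) (div_pos hε hn)] with r h1 h2
  -- The slacks are nonnegative and total `n * (ε / (n + 1))`, so no single one exceeds that; this
  -- turns upper bounds into a lower bound.
  have h3 := Finset.single_le_sum (f := fun q => α q + ε / (n + 1) - u r q)
    (fun q _ => sub_nonneg.2 (h2 q)) (Finset.mem_univ p)
  simp only [Finset.sum_sub_distrib, Finset.sum_add_distrib, h1, hα, Finset.sum_const,
    Finset.card_univ, nsmul_eq_mul] at h3
  have h4 : n * (ε / (n + 1)) + ε / (n + 1) = ε := by field_simp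
  have h5 : 0 < ε / (n + 1) := div_pos hε hn
  have h6 := h2 p
  have h7 : 0 ≤ n * (ε / (n + 1)) := by positivity
  have h8 : 1 ≤ n := by
    have : Nonempty ι := ⟨p⟩
    exact Nat.one_le_cast.2 Fintype.card_pos
  rw [Real.dist_eq, abs_lt]
  constructor
  · linarith
  · nlinarith

/-- The deficits `a * (1 + r) - count` sum to one, as `a` sums to one and the counts to `r`; hence
the largest is positive. -/
lemma FollowsApprox.eventually_count_lt (h : R.FollowsApprox c ω)
    (hE : R.EstimatesConverge c ω w μ σ) (hμ : ∀ i, i ≠ b → μ i < μ b) (hK : 2 ≤ K) (hD : 0 < D) :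
    ∀ᶠ r in atTop, ∀ i j, R.pair r ω = (i, j) → (R.count r ω i j : ℝ) <
      approxAlloc (R.wHat (c.stage K D r) ω) (R.perfHat (c.stage K D r) r ω) (R.sigmaHat r ω) b
        i j * (1 + r) := by
  filter_upwards [hE.eventually_regular, hE.eventually_perfHat_lt hμ,
    hE.eventually_bHat_eq h.toCommon hμ, eventually_ge_atTop (c.init K D)] with r h1 h2 h3 h4 i j hp
  obtain ⟨a, ha, hmax⟩ := h.select r h4 h1 (by rwa [h3])
  rw [h3] at ha
  have hsum : ∑ i', ∑ j', (R.count r ω i' j' : ℝ) = r := by exact_mod_cast sum_count (R := R) r ω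
  rw [← ha.eq_approxAlloc hK h1.1 h1.2 h2 hD]
  simp only [hsum, hp] at hmax
  by_contra hle
  have h5 : ∑ i', ∑ j', (a i' j' * (1 + (r : ℝ)) - (R.count r ω i' j' : ℝ)) ≤ 0 :=
    Finset.sum_nonpos fun i' _ => Finset.sum_nonpos fun j' _ => (hmax i' j').trans (by linarith)
  simp only [Finset.sum_sub_distrib, ← Finset.sum_mul, hsum, ha.sum_eq_one] at h5
  linarith

lemma FollowsApprox.tendsto_count_div (h : R.FollowsApprox c ω)
    (hE : R.EstimatesConverge c ω w μ σ) (hμ : ∀ i, i ≠ b → μ i < μ b) (hK : 2 ≤ K) (hD : 0 < D)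
    (i : Fin K) (j : Fin D) :
    Tendsto (fun r => (R.count r ω i j : ℝ) / r) atTop (𝓝 (approxAlloc w μ σ b i j)) := by
  have hA := isApproxAllocation_approxAlloc hK hE.w_pos hE.σ_pos hμ hD
  refine tendsto_of_eventually_le_of_sum_eq_one (ι := Fin K × Fin D)
    (u := fun r p => (R.count r ω p.1 p.2 : ℝ) / r) (α := fun p => approxAlloc w μ σ b p.1 p.2)
    ?_ ?_ ?_ (i, j)
  · filter_upwards [eventually_gt_atTop 0] with r hr
    rw [← Finset.sum_div, Fintype.sum_prod_type (f := fun p => (R.count r ω p.1 p.2 : ℝ))]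
    have hsum : ∑ i', ∑ j', (R.count r ω i' j' : ℝ) = r := by exact_mod_cast sum_count (R := R) r ω
    rw [hsum]
    exact div_self (by positivity)
  · rw [Fintype.sum_prod_type (f := fun p => approxAlloc w μ σ b p.1 p.2)]
    exact hA.sum_eq_one
  · rintro ⟨i, j⟩ ε hε
    set α := approxAlloc w μ σ b i j
    have hα : 0 < α := hA.pos i j
    have h1 := eventually_le_of_increase_le (x := fun r => (R.count r ω i j : ℝ))
      (y := fun r => α * r) (g := fun r => (r : ℝ))
      (fun r r' hr => by have : (r : ℝ) ≤ r' := by exact_mod_cast hr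
                         exact mul_le_mul_of_nonneg_left this hα.le)
      Nat.mono_cast tendsto_natCast_atTop_atTop ?_ hε
    · filter_upwards [h1, eventually_gt_atTop 0] with r h1 hr
      have hr' : (0 : ℝ) < r := by exact_mod_cast hr
      rw [div_le_iff₀ hr']
      linarith
    · intro δ hδ
      have ht := tendsto_approxAlloc hK hE.w_pos hE.σ_pos hμ hD hE.wHat hE.perfHat hE.sigmaHat i j
      filter_upwards [h.eventually_count_lt hE hμ hK hD,
        ht.eventually (eventually_lt_nhds (show α < α + δ / 2 by linarith)),
        tendsto_natCast_atTop_atTop.eventually_ge_atTop ((α + δ / 2 + 1) / (δ / 2))]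
        with r h1 h2 h3 hlt
      have hp : R.pair r ω = (i, j) := pair_eq_of_count_lt (by exact_mod_cast hlt)
      have h4 := h1 i j hp
      have h5 : (R.count (r + 1) ω i j : ℝ) ≤ R.count r ω i j + 1 := by
        exact_mod_cast count_succ_le r ω i j
      have h6 := (div_le_iff₀ (half_pos hδ)).1 h3
      have h7 : (0 : ℝ) < 1 + r := by positivity
      nlinarith [mul_lt_mul_of_pos_right h2 h7]

/-- Each limiting frequency is positive. The limits `μ`, `σ` need not be the true ones, so this
applies before consistency is known. -/
lemma FollowsApprox.tendsto_count (h : R.FollowsApprox c ω)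
    (hE : R.EstimatesConverge c ω w μ σ) (hμ : ∀ i, i ≠ b → μ i < μ b) (hK : 2 ≤ K) (hD : 0 < D)
    (i : Fin K) (j : Fin D) : Tendsto (fun r => R.count r ω i j) atTop atTop := by
  have hA := isApproxAllocation_approxAlloc hK hE.w_pos hE.σ_pos hμ hD
  have h1 := (h.tendsto_count_div hE hμ hK hD i j).pos_mul_atTop (hA.pos i j)
    (tendsto_natCast_atTop_atTop (R := ℝ))
  refine (tendsto_natCast_atTop_iff (R := ℝ)).1 (h1.congr' ?_)
  filter_upwards [eventually_gt_atTop 0] with r hr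
  have hr' : (0 : ℝ) < r := by exact_mod_cast hr
  field_simp

end Approx

end Execution

lemma tendsto_sq_sub_sq {ι : Type*} {l : Filter ι} {x y : ι → ℝ} {B : ℝ}
    (hx : ∀ᶠ n in l, |x n| ≤ B) (hy : ∀ᶠ n in l, |y n| ≤ B)
    (h : Tendsto (fun n => x n - y n) l (𝓝 0)) :
    Tendsto (fun n => x n ^ 2 - y n ^ 2) l (𝓝 0) := by
  have hb : IsBoundedUnder (· ≤ ·) l (norm ∘ fun n => x n + y n) := by
    refine ⟨B + B, ?_⟩
    rw [eventually_map]
    filter_upwards [hx, hy] with n h1 h2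
    exact (abs_add_le _ _).trans (add_le_add h1 h2)
  refine (h.zero_mul_isBoundedUnder_le hb).congr fun n => by ring

lemma tendsto_zero_of_forall_abs_le {x : ℕ → ℝ} (h : ∀ ε > 0, ∀ᶠ r in atTop, |x r| ≤ ε) :
    Tendsto x atTop (𝓝 0) := by
  rw [Metric.tendsto_nhds]
  intro ε hε
  filter_upwards [h (ε / 2) (half_pos hε)] with r hr
  rw [Real.dist_0_eq_abs]
  linarith

namespace Execution

variable {K D : ℕ} {Ξ Θ Ω : Type*} {R : Execution K D Ξ Θ Ω} {c : Schedule} {ω : Ω}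
  {w : Fin D → ℝ} {μ : Fin K → ℝ} {σ : Fin K → Fin D → ℝ} {b : Fin K}

/-! ### Limiting balance under the balance rule -/

section BalanceRates

lemma count_div_mem_Icc (r : ℕ) (ω : Ω) (i : Fin K) (j : Fin D) :
    0 ≤ (R.count r ω i j : ℝ) / r ∧ (R.count r ω i j : ℝ) / r ≤ 1 :=
  ⟨by positivity, div_le_one_of_le₀ (by exact_mod_cast count_le r ω i j) (by positivity)⟩

lemma abs_count_div_mul_le (r : ℕ) (ω : Ω) (i : Fin K) (j : Fin D) {a : ℝ} :
    |(R.count r ω i j : ℝ) / r * a| ≤ |a| := by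
  have h := count_div_mem_Icc (R := R) r ω i j
  rw [abs_mul, abs_of_nonneg h.1]
  exact mul_le_of_le_one_left (abs_nonneg a) h.2

/-- Within a design, the numbers of simulations divided by `σ w` are balanced. -/
lemma FollowsBalance.eventually_component_le (h : R.FollowsBalance c ω)
    (hE : R.EstimatesConverge c ω w μ σ) (i : Fin K) (j j' : Fin D) {ε : ℝ} (hε : 0 < ε) :
    ∀ᶠ r : ℕ in atTop, (R.count r ω i j : ℝ) / (σ i j * w j) ≤
      (R.count r ω i j' : ℝ) / (σ i j' * w j') + ε * r := by
  have hpos : ∀ j, 0 < σ i j * w j := fun j => mul_pos (hE.σ_pos i j) (hE.w_pos j)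
  refine eventually_le_of_increase_le (x := fun r => (R.count r ω i j : ℝ) / (σ i j * w j))
    (y := fun r => (R.count r ω i j' : ℝ) / (σ i j' * w j')) (g := fun r => (r : ℝ))
    (fun r r' hr => div_le_div_of_nonneg_right (Nat.cast_le.2 (count_mono ω i j' hr)) (hpos j').le)
    Nat.mono_cast tendsto_natCast_atTop_atTop (fun δ hδ => ?_) hε
  -- Of three errors `δ / 3 * r`, two come from replacing estimates by limits (counts are at most
  -- `r`) and one from the extra simulation.
  have hinv : ∀ j, ∀ᶠ r in atTop,
      |1 / (R.sigmaHat r ω i j * R.wHat (c.stage K D r) ω j) - 1 / (σ i j * w j)| < δ / 3 := by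
    intro j
    have h1 := Tendsto.div (tendsto_const_nhds (x := (1 : ℝ)))
      ((hE.sigmaHat i j).mul (hE.wHat j)) (hpos j).ne'
    exact (Metric.tendsto_nhds.1 h1) _ (by positivity)
  filter_upwards [hE.eventually_regular, hinv j, hinv j', eventually_ge_atTop (c.init K D),
    tendsto_natCast_atTop_atTop.eventually_ge_atTop (1 / (σ i j * w j) / (δ / 3))]
    with r h1 h2 h3 h4 h5 hlt
  have hlt' : R.count r ω i j < R.count (r + 1) ω i j := by
    exact_mod_cast (div_lt_div_iff_of_pos_right (hpos j)).1 hlt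
  have hp := pair_eq_of_count_lt hlt'
  have h6 := h.component r h4 h1 j'
  rw [hp] at h6
  have h7 : (R.count (r + 1) ω i j : ℝ) ≤ R.count r ω i j + 1 := by
    exact_mod_cast count_succ_le r ω i j
  have h8 := (div_le_iff₀ (by positivity)).1 h5
  have h9 : ∀ j, (R.count r ω i j : ℝ) ≤ r := fun j => by exact_mod_cast count_le r ω i j
  have h10 : (R.count r ω i j : ℝ) * (1 / (σ i j * w j)) ≤
      (R.count r ω i j : ℝ) * (1 / (R.sigmaHat r ω i j * R.wHat (c.stage K D r) ω j)) +
        δ / 3 * r := by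
    have := (abs_lt.1 h2).1
    have h11 : (0 : ℝ) ≤ R.count r ω i j := by positivity
    nlinarith [h9 j]
  have h12 : (R.count r ω i j' : ℝ) *
      (1 / (R.sigmaHat r ω i j' * R.wHat (c.stage K D r) ω j')) ≤
      (R.count r ω i j' : ℝ) * (1 / (σ i j' * w j')) + δ / 3 * r := by
    have := (abs_lt.1 h3).2
    have h11 : (0 : ℝ) ≤ R.count r ω i j' := by positivity
    nlinarith [h9 j']
  have h13 : (R.count (r + 1) ω i j : ℝ) / (σ i j * w j) ≤
      (R.count r ω i j : ℝ) * (1 / (σ i j * w j)) + 1 / (σ i j * w j) := by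
    rw [mul_one_div, ← add_div]
    exact div_le_div_of_nonneg_right h7 (hpos j).le
  rw [← mul_one_div, ← mul_one_div (R.count r ω i j' : ℝ)] at h6
  rw [← mul_one_div (R.count r ω i j' : ℝ)]
  linarith

lemma FollowsBalance.tendsto_component (h : R.FollowsBalance c ω)
    (hE : R.EstimatesConverge c ω w μ σ) (i : Fin K) (j j' : Fin D) :
    Tendsto (fun r : ℕ => (R.count r ω i j : ℝ) / r / (σ i j * w j) -
      (R.count r ω i j' : ℝ) / r / (σ i j' * w j')) atTop (𝓝 0) := by
  refine tendsto_zero_of_forall_abs_le fun ε hε => ?_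
  filter_upwards [h.eventually_component_le hE i j j' hε, h.eventually_component_le hE i j' j hε,
    eventually_gt_atTop 0] with r h1 h2 h3
  have hr : (0 : ℝ) < r := by exact_mod_cast h3
  rw [div_right_comm, div_right_comm (R.count r ω i j' : ℝ), ← sub_div, abs_div, abs_of_pos hr,
    div_le_iff₀ hr, abs_le]
  constructor <;> linarith

/-- The total balance gap with the limits of the estimates, in terms of frequencies. -/
def limitGap (R : Execution K D Ξ Θ Ω) (σ : Fin K → Fin D → ℝ) (b : Fin K) (ω : Ω) (j : Fin D)
    (r : ℕ) : ℝ :=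
  ((R.count r ω b j : ℝ) / r / σ b j) ^ 2 -
    ∑ i with i ≠ b, ((R.count r ω i j : ℝ) / r / σ i j) ^ 2

lemma EstimatesConverge.tendsto_gap_sub_limitGap (hE : R.EstimatesConverge c ω w μ σ)
    (hb : ∀ᶠ r in atTop, R.bHat r ω = b) (j : Fin D) :
    Tendsto (fun r : ℕ => R.gap r ω j / (r : ℝ) ^ 2 - R.limitGap σ b ω j r) atTop (𝓝 0) := by
  have h1 : ∀ i, Tendsto (fun r : ℕ => ((R.count r ω i j : ℝ) / r / R.sigmaHat r ω i j) ^ 2 -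
      ((R.count r ω i j : ℝ) / r / σ i j) ^ 2) atTop (𝓝 0) := by
    intro i
    have h2 : Tendsto (fun r => (1 / R.sigmaHat r ω i j) ^ 2 - (1 / σ i j) ^ 2) atTop (𝓝 0) := by
      rw [tendsto_sub_nhds_zero_iff]
      exact ((tendsto_const_nhds (x := (1 : ℝ))).div (hE.sigmaHat i j) (hE.σ_pos i j).ne').pow 2
    have h3 : IsBoundedUnder (· ≤ ·) atTop
        (norm ∘ fun r : ℕ => ((R.count r ω i j : ℝ) / r) ^ 2) := by
      refine isBoundedUnder_of ⟨1, fun r => ?_⟩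
      have h4 := count_div_mem_Icc (R := R) r ω i j
      simp only [Function.comp_apply, Real.norm_eq_abs, abs_pow, abs_of_nonneg h4.1]
      exact pow_le_one₀ h4.1 h4.2
    refine (h2.zero_mul_isBoundedUnder_le h3).congr fun r => ?_
    ring
  have h5 := (h1 b).sub (tendsto_finsetSum (Finset.univ.filter fun i => i ≠ b) fun i _ => h1 i)
  simp only [Finset.sum_const_zero, sub_zero] at h5
  refine h5.congr' ?_
  filter_upwards [hb] with r hr
  simp only [gap, hr, limitGap, Finset.sum_sub_distrib, sub_div, Finset.sum_div]
  have h6 : ∀ i, ((R.count r ω i j : ℝ) / R.sigmaHat r ω i j) ^ 2 / (r : ℝ) ^ 2 =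
      ((R.count r ω i j : ℝ) / r / R.sigmaHat r ω i j) ^ 2 := fun i => by
    rw [← div_pow, div_right_comm]
  simp only [h6]
  ring

/-- Balance within each design makes the count over `σ i j * w j` asymptotically independent of `j`,
so all gaps are proportional to `w j ^ 2`. -/
lemma FollowsBalance.tendsto_limitGap_sub (h : R.FollowsBalance c ω)
    (hE : R.EstimatesConverge c ω w μ σ) (j j' : Fin D) :
    Tendsto (fun r : ℕ => R.limitGap σ b ω j r / w j ^ 2 - R.limitGap σ b ω j' r / w j' ^ 2) atTop
      (𝓝 0) := by
  have h1 : ∀ i, Tendsto (fun r : ℕ => ((R.count r ω i j : ℝ) / r / σ i j) ^ 2 / w j ^ 2 -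
      ((R.count r ω i j' : ℝ) / r / σ i j') ^ 2 / w j' ^ 2) atTop (𝓝 0) := by
    intro i
    have h2 := tendsto_sq_sub_sq (B := max |1 / (σ i j * w j)| |1 / (σ i j' * w j')|)
      (Eventually.of_forall fun r => ?_) (Eventually.of_forall fun r => ?_)
      (h.tendsto_component hE i j j')
    · refine h2.congr fun r => ?_
      simp only [div_pow, mul_pow, div_div, mul_assoc]
    · rw [← mul_one_div]
      exact (abs_count_div_mul_le r ω i j).trans (le_max_left _ _)
    · rw [← mul_one_div]
      exact (abs_count_div_mul_le r ω i j').trans (le_max_right _ _)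
  have h5 := (h1 b).sub (tendsto_finsetSum (Finset.univ.filter fun i => i ≠ b) fun i _ => h1 i)
  simp only [Finset.sum_const_zero, sub_zero] at h5
  refine h5.congr fun r => ?_
  simp only [limitGap, Finset.sum_sub_distrib, sub_div, Finset.sum_div]
  ring

/-- The rule looks only at the smallest estimated gap; this transfers its sign, up to `ε`, to the
gap of every component. -/
lemma FollowsBalance.eventually_abs_limitGap_sub_le (h : R.FollowsBalance c ω)
    (hE : R.EstimatesConverge c ω w μ σ) (hb : ∀ᶠ r in atTop, R.bHat r ω = b) (j : Fin D)
    {ε : ℝ} (hε : 0 < ε) : ∀ᶠ r : ℕ in atTop, ∀ j',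
      |R.limitGap σ b ω j r - w j ^ 2 / w j' ^ 2 * (R.gap r ω j' / (r : ℝ) ^ 2)| ≤ ε := by
  refine eventually_all.2 fun j' => ?_
  have h1 := ((h.tendsto_limitGap_sub (b := b) hE j j').const_mul (w j ^ 2)).sub
    ((hE.tendsto_gap_sub_limitGap hb j').const_mul (w j ^ 2 / w j' ^ 2))
  simp only [mul_zero, sub_zero] at h1
  filter_upwards [(Metric.tendsto_nhds.1 h1) ε hε] with r hr
  rw [Real.dist_0_eq_abs] at hr
  refine (le_of_eq ?_).trans hr.le
  congr 1
  have := (hE.w_pos j).ne'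
  field_simp
  ring

/-- The best design's squared count `x` grows only when some gap is negative, the others' sum `y`
only when none is. So each grows only while at most the other plus `o(r ^ 2)`. -/
lemma FollowsBalance.tendsto_limitGap (h : R.FollowsBalance c ω)
    (hE : R.EstimatesConverge c ω w μ σ) (hb : ∀ᶠ r in atTop, R.bHat r ω = b) (j : Fin D) :
    Tendsto (R.limitGap σ b ω j) atTop (𝓝 0) := by
  set x : ℕ → ℝ := fun r => ((R.count r ω b j : ℝ) / σ b j) ^ 2 with hx
  set y : ℕ → ℝ := fun r => ∑ i with i ≠ b, ((R.count r ω i j : ℝ) / σ i j) ^ 2 with hy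
  set g : ℕ → ℝ := fun r => (r : ℝ) ^ 2 with hg
  have hsq : ∀ i, Monotone fun r => ((R.count r ω i j : ℝ) / σ i j) ^ 2 := fun i r r' hr => by
    have h1 : (R.count r ω i j : ℝ) ≤ R.count r' ω i j := by exact_mod_cast count_mono ω i j hr
    have h2 := hE.σ_pos i j
    simp only
    gcongr
  have hxm : Monotone x := hsq b
  have hym : Monotone y := fun r r' hr => Finset.sum_le_sum fun i _ => hsq i hr
  have hgm : Monotone g := fun r r' hr => by
    have : (r : ℝ) ≤ r' := by exact_mod_cast hr
    simp only [hg]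
    gcongr
  have hgt : Tendsto g atTop atTop :=
    (tendsto_pow_atTop two_ne_zero).comp tendsto_natCast_atTop_atTop
  -- One simulation changes a squared count by at most `2 * r + 1`, negligible against `g r = r ^
  -- 2`.
  have hstep : ∀ i r, ((R.count (r + 1) ω i j : ℝ) / σ i j) ^ 2 ≤
      ((R.count r ω i j : ℝ) / σ i j) ^ 2 + (2 * r + 1) * (1 / σ i j) ^ 2 := by
    intro i r
    have h1 : (R.count (r + 1) ω i j : ℝ) ≤ R.count r ω i j + 1 := by
      exact_mod_cast count_succ_le r ω i j
    have h2 : (R.count r ω i j : ℝ) ≤ r := by exact_mod_cast count_le r ω i j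
    have h3 : (R.count (r + 1) ω i j : ℝ) ^ 2 ≤ (R.count r ω i j : ℝ) ^ 2 + (2 * r + 1) := by
      have : (R.count (r + 1) ω i j : ℝ) ^ 2 ≤ ((R.count r ω i j : ℝ) + 1) ^ 2 := by gcongr
      linarith
    have h4 := mul_le_mul_of_nonneg_right h3 (sq_nonneg (1 / σ i j))
    calc _ = (R.count (r + 1) ω i j : ℝ) ^ 2 * (1 / σ i j) ^ 2 := by ring
      _ ≤ _ := h4
      _ = _ := by ring
  have hsmall : ∀ (C δ : ℝ), 0 < δ → ∀ᶠ r : ℕ in atTop, (2 * (r : ℝ) + 1) * C ≤ δ * g r := by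
    intro C δ hδ
    filter_upwards [tendsto_natCast_atTop_atTop.eventually_ge_atTop (3 * |C| / δ),
      eventually_ge_atTop 1] with r h1 h2
    have h2' : (1 : ℝ) ≤ r := by exact_mod_cast h2
    have h3 := (div_le_iff₀ hδ).1 h1
    have h4 := le_abs_self C
    have h5 := abs_nonneg C
    simp only [hg]
    nlinarith
  have hgap : ∀ r : ℕ, 0 < r → R.limitGap σ b ω j r * g r = x r - y r := by
    intro r hr
    have hr' : (r : ℝ) ≠ 0 := by positivity
    simp only [limitGap, hx, hy, hg, sub_mul, Finset.sum_mul]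
    congr 1
    · field_simp
    · exact Finset.sum_congr rfl fun i _ => by field_simp
  have hw : ∀ j', 0 < w j ^ 2 / w j' ^ 2 := fun j' => by
    have := hE.w_pos j
    have := hE.w_pos j'
    positivity
  have upper : ∀ ε > 0, ∀ᶠ r in atTop, x r ≤ y r + ε * g r := by
    refine fun ε hε => eventually_le_of_increase_le hym hgm hgt (fun δ hδ => ?_) hε
    filter_upwards [h.eventually_abs_limitGap_sub_le hE hb j (half_pos hδ),
      hsmall ((1 / σ b j) ^ 2) (δ / 2) (half_pos hδ), hE.eventually_regular, hb,
      eventually_ge_atTop (c.init K D), eventually_gt_atTop 0] with r h1 h2 h3 h4 h5 h6 hlt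
    have hp : R.pair r ω = (b, j) := by
      refine pair_eq_of_count_lt (lt_of_not_ge fun hle => absurd hlt (not_lt.2 ?_))
      rw [hx]
      have h7 : (R.count (r + 1) ω b j : ℝ) ≤ R.count r ω b j := by exact_mod_cast hle
      have h8 := hE.σ_pos b j
      simp only
      gcongr
    obtain ⟨j₀, -, -, hj₀⟩ := h.design r h5 h3
    have hneg : R.gap r ω j₀ < 0 := by
      by_contra hge
      exact (hj₀ (not_lt.1 hge)).1 (by rw [hp, h4])
    have h9 : R.gap r ω j₀ / (r : ℝ) ^ 2 ≤ 0 := div_nonpos_of_nonpos_of_nonneg hneg.le (by positivity)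
    have h10 : R.limitGap σ b ω j r ≤ δ / 2 := by
      have := (abs_le.1 (h1 j₀)).2
      nlinarith [hw j₀]
    have h11 := hgap r h6
    have h12 : 0 ≤ g r := by positivity
    have h13 := hstep b r
    simp only [hx] at h11 ⊢
    nlinarith
  have lower : ∀ ε > 0, ∀ᶠ r in atTop, y r ≤ x r + ε * g r := by
    refine fun ε hε => eventually_le_of_increase_le hxm hgm hgt (fun δ hδ => ?_) hε
    filter_upwards [h.eventually_abs_limitGap_sub_le hE hb j (half_pos hδ),
      hsmall (∑ i with i ≠ b, (1 / σ i j) ^ 2) (δ / 2) (half_pos hδ), hE.eventually_regular, hb,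
      eventually_ge_atTop (c.init K D), eventually_gt_atTop 0] with r h1 h2 h3 h4 h5 h6 hlt
    have hp : (R.pair r ω).1 ≠ b := by
      intro hpb
      refine absurd hlt (not_lt.2 (Finset.sum_le_sum fun i hi => ?_))
      have hi : i ≠ b := by simpa using hi
      have h7 : R.count (r + 1) ω i j = R.count r ω i j := by
        rw [count_succ, if_neg, add_zero]
        intro h8
        rw [h8] at hpb
        exact hi hpb
      rw [h7]
    obtain ⟨j₀, hmin, hj₀, -⟩ := h.design r h5 h3
    have hnn : 0 ≤ R.gap r ω j := by
      refine le_trans (le_of_not_gt fun hlt => hp ?_) (hmin j)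
      rw [hj₀ hlt, h4]
    have h9 : 0 ≤ R.gap r ω j / (r : ℝ) ^ 2 := by positivity
    have h10 : -(δ / 2) ≤ R.limitGap σ b ω j r := by
      have := (abs_le.1 (h1 j)).1
      nlinarith [hw j]
    have h11 := hgap r h6
    have h12 : 0 ≤ g r := by positivity
    have h13 : y (r + 1) ≤ y r + (2 * r + 1) * ∑ i with i ≠ b, (1 / σ i j) ^ 2 := by
      rw [Finset.mul_sum, ← Finset.sum_add_distrib]
      exact Finset.sum_le_sum fun i _ => hstep i r
    nlinarith
  refine tendsto_zero_of_forall_abs_le fun ε hε => ?_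
  filter_upwards [upper ε hε, lower ε hε, eventually_gt_atTop 0] with r h1 h2 h3
  have h4 := hgap r h3
  have h5 : 0 < g r := by
    have : (0 : ℝ) < r := by exact_mod_cast h3
    positivity
  rw [abs_le]
  constructor
  · by_contra hlt
    nlinarith
  · by_contra hlt
    nlinarith

end BalanceRates

end Execution

namespace Execution

variable {K D : ℕ} {Ξ Θ Ω : Type*} {R : Execution K D Ξ Θ Ω} {c : Schedule} {ω : Ω}
  {w : Fin D → ℝ} {μ : Fin K → ℝ} {σ : Fin K → Fin D → ℝ} {b : Fin K}

/-! ### The balance rule simulates every pair infinitely often -/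

section BalanceCounts

lemma exists_frequently_pair_eq {i : Fin K} (h : ∃ᶠ r in atTop, (R.pair r ω).1 = i) :
    ∃ j, ∃ᶠ r in atTop, R.pair r ω = (i, j) := by
  by_contra! hne
  refine h ?_
  filter_upwards [eventually_all.2 hne] with r hr hi
  exact hr (R.pair r ω).2 (Prod.ext hi rfl)

lemma exists_frequently_fst_eq (ω : Ω) : ∃ i, ∃ᶠ r in atTop, (R.pair r ω).1 = i := by
  by_contra! hne
  obtain ⟨r, hr⟩ := (eventually_all.2 hne).exists
  exact hr _ rfl

lemma not_frequently_pair_eq {i : Fin K} (h : ¬ ∃ᶠ r in atTop, (R.pair r ω).1 = i) (j : Fin D) :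
    ¬ ∃ᶠ r in atTop, R.pair r ω = (i, j) :=
  fun hj => h (hj.mono fun r hr => by rw [hr])

lemma EstimatesConverge.tendsto_count_div_sigmaHat_atTop (hE : R.EstimatesConverge c ω w μ σ)
    {i : Fin K} {j : Fin D} (h : Tendsto (fun r => R.count r ω i j) atTop atTop) :
    Tendsto (fun r => ((R.count r ω i j : ℝ) / R.sigmaHat r ω i j) ^ 2) atTop atTop := by
  have h1 := (tendsto_natCast_atTop_atTop (R := ℝ)).comp h
  have h2 := h1.atTop_mul_pos (inv_pos.2 (hE.σ_pos i j))
    ((hE.sigmaHat i j).inv₀ (hE.σ_pos i j).ne')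
  refine ((tendsto_pow_atTop two_ne_zero).comp h2).congr fun r => ?_
  simp [div_eq_mul_inv]

lemma EstimatesConverge.exists_tendsto_count_div_sigmaHat (hE : R.EstimatesConverge c ω w μ σ)
    {i : Fin K} (h : ¬ ∃ᶠ r in atTop, (R.pair r ω).1 = i) (j : Fin D) :
    ∃ l, Tendsto (fun r => ((R.count r ω i j : ℝ) / R.sigmaHat r ω i j) ^ 2) atTop (𝓝 l) := by
  obtain ⟨n, hn⟩ := tendsto_count_of_not_frequently (not_frequently_pair_eq h j)
  have h1 : Tendsto (fun r => (R.count r ω i j : ℝ)) atTop (𝓝 n) :=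
    tendsto_const_nhds.congr' (hn.mono fun r hr => by simp only [hr])
  exact ⟨_, (h1.div (hE.sigmaHat i j) (hE.σ_pos i j).ne').pow 2⟩

/-- Some component `j'` recurs. If `j` froze, its ratio would stay bounded while that of `j'`
diverges, so `j'` could not remain the minimizer. -/
lemma FollowsBalance.tendsto_count_of_frequently (h : R.FollowsBalance c ω)
    (hE : R.EstimatesConverge c ω w μ σ) {i : Fin K}
    (hi : ∃ᶠ r in atTop, (R.pair r ω).1 = i) (j : Fin D) :
    Tendsto (fun r => R.count r ω i j) atTop atTop := by
  obtain ⟨j', hj'⟩ := exists_frequently_pair_eq hi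
  by_contra hnot
  obtain ⟨n, hn⟩ := tendsto_count_of_not_frequently
    (fun hf => hnot (Execution.tendsto_count_of_frequently hf))
  have hlim : ∀ j, Tendsto (fun r => (R.sigmaHat r ω i j * R.wHat (c.stage K D r) ω j)⁻¹) atTop
      (𝓝 (σ i j * w j)⁻¹) := fun j => ((hE.sigmaHat i j).mul (hE.wHat j)).inv₀
        (mul_pos (hE.σ_pos i j) (hE.w_pos j)).ne'
  have h1 : Tendsto (fun r => (R.count r ω i j : ℝ) *
      (R.sigmaHat r ω i j * R.wHat (c.stage K D r) ω j)⁻¹) atTop (𝓝 (n * (σ i j * w j)⁻¹)) := by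
    refine Tendsto.mul (tendsto_const_nhds.congr' (hn.mono fun r hr => ?_)) (hlim j)
    simp only [hr]
  have h2 : Tendsto (fun r => (R.count r ω i j' : ℝ) *
      (R.sigmaHat r ω i j' * R.wHat (c.stage K D r) ω j')⁻¹) atTop atTop :=
    ((tendsto_natCast_atTop_atTop (R := ℝ)).comp
      (Execution.tendsto_count_of_frequently hj')).atTop_mul_pos
      (inv_pos.2 (mul_pos (hE.σ_pos i j') (hE.w_pos j'))) (hlim j')
  obtain ⟨r, hp, hreg, hinit, hlt, hgt⟩ := (hj'.and_eventually (hE.eventually_regular.and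
    ((eventually_ge_atTop (c.init K D)).and
      ((h1.eventually (eventually_lt_nhds (lt_add_one _))).and
        (h2.eventually_ge_atTop (n * (σ i j * w j)⁻¹ + 1)))))).exists
  have h3 := h.component r hinit hreg j
  simp only [hp, div_eq_mul_inv] at h3
  linarith

/-- If the best design froze while another recurs, every gap would finally be negative and the rule
would choose the best design. -/
lemma FollowsBalance.frequently_best (h : R.FollowsBalance c ω)
    (hE : R.EstimatesConverge c ω w μ σ) (hb : ∀ᶠ r in atTop, R.bHat r ω = b) :
    ∃ᶠ r in atTop, (R.pair r ω).1 = b := by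
  by_contra hnot
  obtain ⟨i, hi⟩ := exists_frequently_fst_eq (R := R) ω
  have hib : i ≠ b := fun he => hnot (he ▸ hi)
  have hgap : ∀ j, ∀ᶠ r in atTop, R.gap r ω j < 0 := by
    intro j
    obtain ⟨l, hl⟩ := hE.exists_tendsto_count_div_sigmaHat hnot j
    have h1 := hE.tendsto_count_div_sigmaHat_atTop (h.tendsto_count_of_frequently hE hi j)
    filter_upwards [hb, hl.eventually (eventually_lt_nhds (lt_add_one l)),
      h1.eventually_ge_atTop (l + 1)] with r g1 g2 g3
    have g4 := Finset.single_le_sum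
      (f := fun i => ((R.count r ω i j : ℝ) / R.sigmaHat r ω i j) ^ 2)
      (s := Finset.univ.filter fun i => i ≠ b) (fun i _ => sq_nonneg _) (by simpa using hib)
    simp only [gap, g1]
    linarith
  refine hnot (Eventually.frequently ?_)
  filter_upwards [eventually_all.2 hgap, hb, hE.eventually_regular,
    eventually_ge_atTop (c.init K D)] with r g1 g2 g3 g4
  obtain ⟨j₀, -, hj₀, -⟩ := h.design r g4 g3
  rw [hj₀ (g1 j₀), g2]

lemma FollowsBalance.exists_frequently_ne_best (h : R.FollowsBalance c ω)
    (hE : R.EstimatesConverge c ω w μ σ) (hb : ∀ᶠ r in atTop, R.bHat r ω = b) :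
    ∃ i, i ≠ b ∧ ∃ᶠ r in atTop, (R.pair r ω).1 = i := by
  by_contra! hnot
  have hgap : ∀ j, ∀ᶠ r in atTop, 0 ≤ R.gap r ω j := by
    intro j
    have h2 : ∀ i, ∃ l, i ≠ b →
        Tendsto (fun r => ((R.count r ω i j : ℝ) / R.sigmaHat r ω i j) ^ 2) atTop (𝓝 l) := by
      intro i
      by_cases hi : i = b
      · exact ⟨0, fun hne => absurd hi hne⟩
      · obtain ⟨l, hl⟩ := hE.exists_tendsto_count_div_sigmaHat (not_frequently.2 (hnot i hi)) j
        exact ⟨l, fun _ => hl⟩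
    choose l hl using h2
    have h3 := tendsto_finsetSum (Finset.univ.filter fun i => i ≠ b)
      fun i hi => hl i (Finset.mem_filter.1 hi).2
    have h1 := hE.tendsto_count_div_sigmaHat_atTop
      (h.tendsto_count_of_frequently hE (h.frequently_best hE hb) j)
    filter_upwards [hb, h3.eventually (eventually_lt_nhds (lt_add_one _)),
      h1.eventually_ge_atTop (∑ i with i ≠ b, l i + 1)] with r g1 g2 g3
    simp only [gap, g1]
    linarith
  refine h.frequently_best hE hb ?_
  filter_upwards [eventually_all.2 hgap, hb, hE.eventually_regular,
    eventually_ge_atTop (c.init K D)] with r g1 g2 g3 g4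
  obtain ⟨j₀, -, -, hj₀⟩ := h.design r g4 g3
  rw [← g2]
  exact (hj₀ (g1 j₀)).1

/-- Contribution of a design to the denominator of the local balance score. -/
def scoreVar (R : Execution K D Ξ Θ Ω) (c : Schedule) (ω : Ω) (i : Fin K) (r : ℕ) : ℝ :=
  ∑ j, R.sigmaHat r ω i j ^ 2 * R.wHat (c.stage K D r) ω j ^ 2 / (R.count r ω i j : ℝ)

lemma EstimatesConverge.tendsto_scoreVar_zero (hE : R.EstimatesConverge c ω w μ σ) {i : Fin K}
    (h : ∀ j, Tendsto (fun r => R.count r ω i j) atTop atTop) :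
    Tendsto (R.scoreVar c ω i) atTop (𝓝 0) := by
  rw [← Finset.sum_const_zero (s := (Finset.univ : Finset (Fin D))) (M := ℝ)]
  exact tendsto_finsetSum _ fun j _ => (((hE.sigmaHat i j).pow 2).mul ((hE.wHat j).pow 2)).div_atTop
    ((tendsto_natCast_atTop_atTop (R := ℝ)).comp (h j))

lemma EstimatesConverge.exists_tendsto_scoreVar (hE : R.EstimatesConverge c ω w μ σ) (hD : 0 < D)
    {i : Fin K} (hcount : ∀ j, ∃ n : ℕ, 0 < n ∧ ∀ᶠ r in atTop, R.count r ω i j = n) :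
    ∃ l, 0 < l ∧ Tendsto (R.scoreVar c ω i) atTop (𝓝 l) := by
  choose n hn0 hn using hcount
  refine ⟨∑ j, σ i j ^ 2 * w j ^ 2 / n j, Finset.sum_pos (fun j _ => ?_) ⟨⟨0, hD⟩, by simp⟩,
    tendsto_finsetSum _ fun j _ => ?_⟩
  · have := hE.σ_pos i j
    have := hE.w_pos j
    have : (0 : ℝ) < n j := by exact_mod_cast hn0 j
    positivity
  · refine (((hE.sigmaHat i j).pow 2).mul ((hE.wHat j).pow 2)).div
      (tendsto_const_nhds.congr' ((hn j).mono fun r hr => by simp only [hr]))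
      (by exact_mod_cast (hn0 j).ne')

/-- A frozen non-best design keeps a bounded score, since its variance term has a positive limit. A
recurring non-best design `i₁` has a score tending to infinity, so it could not be preferred. -/
lemma FollowsBalance.frequently_fst_eq (h : R.FollowsBalance c ω)
    (hE : R.EstimatesConverge c ω w μ σ) (hμ : ∀ i, i ≠ b → μ i < μ b) (hD : 0 < D)
    (hn0 : 0 < c.n0) (i : Fin K) : ∃ᶠ r in atTop, (R.pair r ω).1 = i := by
  have hb := hE.eventually_bHat_eq h.toCommon hμ
  have hbest := h.frequently_best hE hb
  by_cases hib : i = b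
  · rwa [hib]
  by_contra hnot
  obtain ⟨i₁, hi₁b, hi₁⟩ := h.exists_frequently_ne_best hE hb
  have hcount : ∀ j, ∃ n : ℕ, 0 < n ∧ ∀ᶠ r in atTop, R.count r ω i j = n := by
    intro j
    obtain ⟨n, hn⟩ := tendsto_count_of_not_frequently (not_frequently_pair_eq hnot j)
    refine ⟨n, ?_, hn⟩
    -- Initialization makes the frozen count positive; at count 0 the variance term would be 0 by
    -- the division convention.
    obtain ⟨r, hr, hr'⟩ := (hn.and (eventually_ge_atTop (c.init K D))).exists
    have := count_mono (R := R) ω i j hr'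
    have := h.init_count i j
    simp only at *
    omega
  obtain ⟨l, hl0, hl⟩ := hE.exists_tendsto_scoreVar hD hcount
  have hvb := hE.tendsto_scoreVar_zero (h.tendsto_count_of_frequently hE hbest)
  have hv1 := hE.tendsto_scoreVar_zero (h.tendsto_count_of_frequently hE hi₁)
  have hscore : ∀ i r, R.score c r ω i =
      (R.perfHat (c.stage K D r) r ω (R.bHat r ω) - R.perfHat (c.stage K D r) r ω i) ^ 2 /
        (R.scoreVar c ω (R.bHat r ω) r + R.scoreVar c ω i r) := fun i r => rfl
  have hnum : ∀ i, Tendsto (fun r => (R.perfHat (c.stage K D r) r ω b -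
      R.perfHat (c.stage K D r) r ω i) ^ 2) atTop (𝓝 ((μ b - μ i) ^ 2)) := fun i =>
    ((hE.perfHat b).sub (hE.perfHat i)).pow 2
  have hs0 := (hnum i).div (hvb.add hl) (by rw [zero_add]; exact hl0.ne')
  have hden : Tendsto (fun r => R.scoreVar c ω b r + R.scoreVar c ω i₁ r) atTop (𝓝[>] 0) := by
    refine tendsto_nhdsWithin_iff.2 ⟨by simpa using hvb.add hv1, ?_⟩
    have hcb : ∀ᶠ r in atTop, ∀ j, 0 < R.count r ω b j := eventually_all.2 fun j =>
      (h.tendsto_count_of_frequently hE hbest j).eventually_gt_atTop 0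
    filter_upwards [hE.eventually_regular, hcb] with r hr hcb
    refine Set.mem_Ioi.2 <| add_pos_of_pos_of_nonneg
      (Finset.sum_pos (fun j _ => ?_) ⟨⟨0, hD⟩, Finset.mem_univ _⟩)
      (Finset.sum_nonneg fun j _ => by positivity)
    have := hr.1 j
    have := hr.2 b j
    have : (0 : ℝ) < R.count r ω b j := by exact_mod_cast hcb j
    positivity
  have hs1 := (hnum i₁).pos_mul_atTop (pow_pos (sub_pos.2 (hμ i₁ hi₁b)) 2)
    (tendsto_inv_nhdsGT_zero.comp hden)
  set B := (μ b - μ i) ^ 2 / (0 + l)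
  obtain ⟨r, hp, g1, g2, g3, g4, g5⟩ := (hi₁.and_eventually (hb.and (hE.eventually_regular.and
    ((eventually_ge_atTop (c.init K D)).and ((hs0.eventually (eventually_lt_nhds
      (lt_add_one B))).and (hs1.eventually_ge_atTop (B + 1))))))).exists
  obtain ⟨j₀, -, hneg, hnn⟩ := h.design r g3 g2
  have hge : 0 ≤ R.gap r ω j₀ := by
    by_contra hlt
    exact hi₁b (by rw [← hp, hneg (not_le.1 hlt), g1])
  have h1 := (hnn hge).2 i (by rwa [g1])
  rw [hp, hscore, hscore, g1] at h1
  simp only [Function.comp_apply, ← div_eq_mul_inv] at g5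
  exact absurd (g5.trans h1) (not_le.2 g4)

lemma FollowsBalance.tendsto_count (h : R.FollowsBalance c ω)
    (hE : R.EstimatesConverge c ω w μ σ) (hμ : ∀ i, i ≠ b → μ i < μ b) (hD : 0 < D)
    (hn0 : 0 < c.n0) (i : Fin K) (j : Fin D) :
    Tendsto (fun r => R.count r ω i j) atTop atTop :=
  h.tendsto_count_of_frequently hE (h.frequently_fst_eq hE hμ hD hn0 i) j

end BalanceCounts

end Execution

lemma Model.pos_of_wc_sum {K D : ℕ} {Ξ Θ : Type*} [MeasurableSpace Ξ] (S : Model K D Ξ Θ) :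
    0 < D := by
  rcases Nat.eq_zero_or_pos D with h | h
  · subst h
    simpa using S.wc_sum
  · exact h

namespace Execution

variable {K D : ℕ} {Ξ Θ Ω : Type*} {R : Execution K D Ξ Θ Ω} {c : Schedule} {ω : Ω}

/-! ### Linear relations among outputs have probability zero -/

section NoTies

/-- Such a relation would determine the last output with nonzero coefficient from the history, which
already contains the current pair. Where the coefficient is 0 the quotient below is a harmless
default. -/
lemma ae_forall_weighted_sum_ne [MeasurableSpace Ξ] [MeasurableSpace Θ] [MeasurableSpace Ω]
    {P : Measure Ω} [IsProbabilityMeasure P] {S : Model K D Ξ Θ} (hR : R.IsMeasurable)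
    (hN : Tendsto c.N atTop atTop) (hsim : R.SimulatesCurrentEstimate S c P)
    (hatom : ∀ i j θ x, S.outLaw i j θ {x} = 0) (a : Fin K × Fin D → ℝ) (v : ℝ) :
    ∀ᵐ ω ∂P, ∀ r, (∃ s < r, a (R.pair s ω) ≠ 0) →
      ∑ s ∈ Finset.range r, a (R.pair s ω) * R.out s ω ≠ v := by
  have h : ∀ᵐ ω ∂P, ∀ r, R.out r ω ≠
      (v - ∑ s ∈ Finset.range r, a (R.pair s ω) * R.out s ω) / a (R.pair r ω) := by
    refine ae_all_iff.2 fun r => ae_out_ne hR hN hsim hatom r ?_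
    have ha : Measurable a := Measurable.of_discrete
    have h1 : ∀ s ≤ r, Measurable[R.history c r] fun ω => a (R.pair s ω) := fun s hs =>
      ha.comp (measurable_pair_history hs)
    have h2 : Measurable[R.history c r] fun ω =>
        ∑ s ∈ Finset.range r, a (R.pair s ω) * R.out s ω :=
      Finset.measurable_fun_sum _ fun s hs => (h1 s (Finset.mem_range.1 hs).le).mul
        (measurable_out_history (Finset.mem_range.1 hs))
    exact (measurable_const.sub h2).div (h1 r le_rfl)
  filter_upwards [h] with ω hω r
  induction r with
  | zero => rintro ⟨s, hs, -⟩; omega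
  | succ r ih =>
    rintro ⟨s, hs, has⟩ hsum
    rw [Finset.sum_range_succ] at hsum
    by_cases har : a (R.pair r ω) = 0
    · refine ih ⟨s, lt_of_le_of_ne (Nat.lt_succ_iff.1 hs) fun he => has (he ▸ har), has⟩ ?_
      rw [← hsum, har]; ring
    · refine hω r ?_
      rw [eq_div_iff har, ← hsum]; ring

lemma sum_filter_eq_count_mul_muHat (r : ℕ) (ω : Ω) (i : Fin K) (j : Fin D)
    (h : R.count r ω i j ≠ 0) :
    ∑ s ∈ Finset.range r with R.pair s ω = (i, j), R.out s ω =
      R.count r ω i j * R.muHat r ω i j := by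
  rw [muHat, mul_div_cancel₀]
  exact_mod_cast h

/-- Difference of the coefficients of the sample means in the performance of two designs. -/
def contrast (w : Fin D → ℝ) (i i' : Fin K) (p : Fin K × Fin D) : ℝ :=
  (if p.1 = i then w p.2 else 0) - if p.1 = i' then w p.2 else 0

lemma sum_contrast_mul (w : Fin D → ℝ) (i i' : Fin K) (m : Fin K → Fin D → ℝ) :
    ∑ p, contrast w i i' p * m p.1 p.2 = ∑ j, w j * m i j - ∑ j, w j * m i' j := by
  rw [Fintype.sum_prod_type (f := fun p => contrast w i i' p * m p.1 p.2)]
  simp only [contrast, sub_mul, Finset.sum_sub_distrib, ite_mul, zero_mul]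
  congr 1
  · rw [Finset.sum_comm]; simp
  · rw [Finset.sum_comm]; simp

/-- Coefficients of the outputs in a contrast of sample means that involves the pairs in `A`
only, when the pair `p` has been simulated `n p` times. -/
def contrastCoef (w : Fin D → ℝ) (i i' : Fin K) (A : Finset (Fin K × Fin D))
    (n : Fin K → Fin D → ℕ) (p : Fin K × Fin D) : ℝ :=
  if p ∈ A then contrast w i i' p / n p.1 p.2 else 0

lemma sum_contrastCoef_mul_out (w : Fin D → ℝ) (i i' : Fin K) (A : Finset (Fin K × Fin D))
    (r : ℕ) (ω : Ω) (hcount : ∀ i j, R.count r ω i j ≠ 0) :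
    ∑ s ∈ Finset.range r, contrastCoef w i i' A (R.count r ω) (R.pair s ω) * R.out s ω =
      ∑ p ∈ A, contrast w i i' p * R.muHat r ω p.1 p.2 := by
  rw [← Finset.sum_fiberwise (Finset.range r) (fun s => R.pair s ω)]
  have h1 : ∀ p, ∑ s ∈ Finset.range r with R.pair s ω = p,
      contrastCoef w i i' A (R.count r ω) (R.pair s ω) * R.out s ω =
      if p ∈ A then contrast w i i' p * R.muHat r ω p.1 p.2 else 0 := by
    rintro ⟨k, j⟩
    have h2 : ∀ s ∈ (Finset.range r).filter (fun s => R.pair s ω = (k, j)),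
        contrastCoef w i i' A (R.count r ω) (R.pair s ω) * R.out s ω =
          contrastCoef w i i' A (R.count r ω) (k, j) * R.out s ω := fun s hs => by
      rw [(Finset.mem_filter.1 hs).2]
    rw [Finset.sum_congr rfl h2, ← Finset.mul_sum,
      sum_filter_eq_count_mul_muHat r ω k j (hcount k j), contrastCoef]
    have h3 : (R.count r ω k j : ℝ) ≠ 0 := by exact_mod_cast hcount k j
    split_ifs
    · field_simp
    · simp
  rw [Finset.sum_congr rfl fun p _ => h1 p]
  simp

end NoTies

/-! ### From provisional limits to true limits -/

section Limits

lemma filter_eq_of_pair_ne {i : Fin K} {j : Fin D} {r₀ : ℕ}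
    (h : ∀ r ≥ r₀, R.pair r ω ≠ (i, j)) {r : ℕ} (hr : r₀ ≤ r) :
    (Finset.range r).filter (fun s => R.pair s ω = (i, j)) =
      (Finset.range r₀).filter (fun s => R.pair s ω = (i, j)) := by
  ext s
  simp only [Finset.mem_filter, Finset.mem_range]
  constructor
  · rintro ⟨h1, h2⟩
    exact ⟨not_le.1 fun h3 => h s h3 h2, h2⟩
  · rintro ⟨h1, h2⟩
    exact ⟨h1.trans_le hr, h2⟩

lemma muHat_eq_of_pair_ne {i : Fin K} {j : Fin D} {r₀ : ℕ}
    (h : ∀ r ≥ r₀, R.pair r ω ≠ (i, j)) {r : ℕ} (hr : r₀ ≤ r) :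
    R.muHat r ω i j = R.muHat r₀ ω i j := by
  simp only [muHat, count, filter_eq_of_pair_ne h hr]

lemma sigmaHat_eq_of_pair_ne {i : Fin K} {j : Fin D} {r₀ : ℕ}
    (h : ∀ r ≥ r₀, R.pair r ω ≠ (i, j)) {r : ℕ} (hr : r₀ ≤ r) :
    R.sigmaHat r ω i j = R.sigmaHat r₀ ω i j := by
  simp only [sigmaHat, muHat_eq_of_pair_ne h hr, count, filter_eq_of_pair_ne h hr]

/-- Zero sample variance would make two outputs equal to their common mean. -/
lemma sigmaHat_pos {r : ℕ} {i : Fin K} {j : Fin D}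
    (hne : ∀ r, ∀ s < r, R.out r ω ≠ R.out s ω) (h2 : 2 ≤ R.count r ω i j) :
    0 < R.sigmaHat r ω i j := by
  have hc : (2 : ℝ) ≤ R.count r ω i j := by exact_mod_cast h2
  refine Real.sqrt_pos.2 (div_pos ?_ (by linarith))
  refine lt_of_le_of_ne (Finset.sum_nonneg fun _ _ => sq_nonneg _) fun h0 => ?_
  have h1 := (Finset.sum_eq_zero_iff_of_nonneg fun _ _ => sq_nonneg _).1 h0.symm
  obtain ⟨s, hs, s', hs', hss⟩ := Finset.one_lt_card.1 (show 1 < R.count r ω i j by omega)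
  have e1 := sub_eq_zero.1 (pow_eq_zero_iff two_ne_zero |>.1 (h1 s hs))
  have e2 := sub_eq_zero.1 (pow_eq_zero_iff two_ne_zero |>.1 (h1 s' hs'))
  rcases lt_or_gt_of_ne hss with h | h
  · exact hne s' s h (e2.trans e1.symm)
  · exact hne s s' h (e1.trans e2.symm)

lemma sigmaHat_eq_sqrt {r : ℕ} {i : Fin K} {j : Fin D} (h2 : 2 ≤ R.count r ω i j) :
    R.sigmaHat r ω i j = √(((∑ s ∈ Finset.range r with R.pair s ω = (i, j), R.out s ω ^ 2) /
      (R.count r ω i j : ℝ) - R.muHat r ω i j ^ 2) * (1 + 1 / ((R.count r ω i j : ℝ) - 1))) := by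
  have hc : (2 : ℝ) ≤ R.count r ω i j := by exact_mod_cast h2
  have h1 : ∑ s ∈ Finset.range r with R.pair s ω = (i, j), (R.out s ω - R.muHat r ω i j) ^ 2 =
      ∑ s ∈ Finset.range r with R.pair s ω = (i, j), R.out s ω ^ 2 -
        R.count r ω i j * R.muHat r ω i j ^ 2 := by
    simp only [sub_sq, Finset.sum_add_distrib, Finset.sum_sub_distrib, ← Finset.sum_mul,
      ← Finset.mul_sum, Finset.sum_const, nsmul_eq_mul]
    rw [sum_filter_eq_count_mul_muHat r ω i j (by omega)]
    simp only [count]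
    ring
  have h3 : (R.count r ω i j : ℝ) ≠ 0 := by linarith
  have h4 : (R.count r ω i j : ℝ) - 1 ≠ 0 := by linarith
  rw [sigmaHat, h1]
  congr 1
  field_simp
  ring

lemma two_le_count (hC : R.Common c ω) (hn0 : 2 ≤ c.n0) {r : ℕ} (hr : c.init K D ≤ r) (i : Fin K)
    (j : Fin D) : 2 ≤ R.count r ω i j :=
  (hn0.trans_eq (hC.init_count i j).symm).trans (count_mono ω i j hr)

lemma tendsto_sigmaHat_of_tendsto_moments (hC : R.Common c ω) (hn0 : 2 ≤ c.n0) {i : Fin K}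
    {j : Fin D} (hcount : Tendsto (fun r => (R.count r ω i j : ℝ)) atTop atTop) {m q : ℝ}
    (h1 : Tendsto (fun r => R.muHat r ω i j) atTop (𝓝 m))
    (h2 : Tendsto (fun r => (∑ s ∈ Finset.range r with R.pair s ω = (i, j), R.out s ω ^ 2) /
      (R.count r ω i j : ℝ)) atTop (𝓝 q)) :
    Tendsto (fun r => R.sigmaHat r ω i j) atTop (𝓝 √(q - m ^ 2)) := by
  have h3 : Tendsto (fun r => 1 + 1 / ((R.count r ω i j : ℝ) - 1)) atTop (𝓝 (1 + 0)) :=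
    tendsto_const_nhds.add (tendsto_const_nhds.div_atTop
      (tendsto_atTop_add_const_right _ (-1) hcount))
  have h4 := ((h2.sub (h1.pow 2)).mul h3).sqrt
  rw [add_zero, mul_one] at h4
  refine h4.congr' ?_
  filter_upwards [eventually_ge_atTop (c.init K D)] with r hr
  rw [sigmaHat_eq_sqrt (two_le_count hC hn0 hr i j)]

variable [MeasurableSpace Ξ] {S : Model K D Ξ Θ}

/-- The almost sure properties of a path from which the limits of the estimates are deduced. -/
structure RegularPath (R : Execution K D Ξ Θ Ω) (S : Model K D Ξ Θ) (ω : Ω) : Prop where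
  wHat : ∀ j, Tendsto (fun t => R.wHat t ω j) atTop (𝓝 (S.wc j))
  muHat : ∀ i j, Tendsto (fun r => (R.count r ω i j : ℝ)) atTop atTop →
    Tendsto (fun r => R.muHat r ω i j) atTop (𝓝 (S.mu i j))
  sigmaHat : ∀ c : Schedule, R.Common c ω → 2 ≤ c.n0 → ∀ i j,
    Tendsto (fun r => (R.count r ω i j : ℝ)) atTop atTop →
    Tendsto (fun r => R.sigmaHat r ω i j) atTop (𝓝 (S.sigma i j))
  out_ne : ∀ r, ∀ s < r, R.out r ω ≠ R.out s ω
  contrast_ne : ∀ (i i' : Fin K) (A : Finset (Fin K × Fin D)) (n : Fin K → Fin D → ℕ) (r : ℕ),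
    (∃ s < r, contrastCoef S.wc i i' A n (R.pair s ω) ≠ 0) →
      ∑ s ∈ Finset.range r, contrastCoef S.wc i i' A n (R.pair s ω) * R.out s ω ≠
        -∑ p ∈ Aᶜ, contrast S.wc i i' p * S.mu p.1 p.2

lemma ae_regularPath [MetricSpace Θ] [CompactSpace Θ] [MeasurableSpace Θ] [BorelSpace Θ]
    [MeasurableSpace Ω] {P : Measure Ω} [IsProbabilityMeasure P] (hR : R.IsMeasurable)
    (hN : Tendsto c.N atTop atTop) (hsim : R.SimulatesCurrentEstimate S c P)
    (hmom : S.MomentsContinuous) (hatom : ∀ i j θ x, S.outLaw i j θ {x} = 0)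
    (hest : ∀ᵐ ω ∂P,
      Tendsto (fun t => (R.wHat t ω, R.θHat t ω)) atTop (𝓝 (S.wc, S.θc))) :
    ∀ᵐ ω ∂P, R.RegularPath S ω := by
  have hL : ∀ i j θ, MemLp id 4 (S.outLaw i j θ) := fun i j => (hmom i j).1
  have hθ : ∀ᵐ ω ∂P, Tendsto (fun t => R.θHat t ω) atTop (𝓝 S.θc) :=
    hest.mono fun ω h => (continuous_snd.tendsto _).comp h
  have h1 : ∀ᵐ ω ∂P, ∀ i j, _ := ae_all_iff.2 fun i => ae_all_iff.2 fun j =>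
    ae_tendsto_moment hR hN hsim hθ hL (k := 1) (by norm_num) (fun i j => (hmom i j).2.1)
      (fun i j => (hmom i j).2.2.1) i j
  have h2 : ∀ᵐ ω ∂P, ∀ i j, _ := ae_all_iff.2 fun i => ae_all_iff.2 fun j =>
    ae_tendsto_moment hR hN hsim hθ hL (k := 2) (by norm_num) (fun i j => (hmom i j).2.2.1)
      (fun i j => (hmom i j).2.2.2) i j
  have h3 : ∀ᵐ ω ∂P, ∀ r, ∀ s < r, R.out r ω ≠ R.out s ω :=
    ae_all_iff.2 fun r => ae_all_iff.2 fun s => by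
      by_cases hs : s < r
      · filter_upwards [ae_out_ne hR hN hsim hatom r (measurable_out_history hs)] with ω h _ using h
      · exact ae_of_all _ fun ω h => absurd h hs
  -- The counts in the coefficients are random, but only countably many values of `n` are possible,
  -- and the limiting weights are deterministic.
  have h4 : ∀ᵐ ω ∂P, ∀ (i i' : Fin K) (A : Finset (Fin K × Fin D)) (n : Fin K → Fin D → ℕ), _ :=
    ae_all_iff.2 fun i => ae_all_iff.2 fun i' => ae_all_iff.2 fun A => ae_all_iff.2 fun n =>
      ae_forall_weighted_sum_ne hR hN hsim hatom (contrastCoef S.wc i i' A n)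
        (-∑ p ∈ Aᶜ, contrast S.wc i i' p * S.mu p.1 p.2)
  filter_upwards [hest, h1, h2, h3, h4] with ω he h1 h2 h3 h4
  have hmu : ∀ i j, Tendsto (fun r => (R.count r ω i j : ℝ)) atTop atTop →
      Tendsto (fun r => R.muHat r ω i j) atTop (𝓝 (S.mu i j)) := fun i j hc => by
    have := h1 i j hc
    simp only [pow_one] at this
    rwa [Model.mu_eq]
  refine ⟨fun j => ?_, hmu, fun c hC hn0 i j hc => ?_, h3, h4⟩
  · exact (tendsto_pi_nhds.1 ((continuous_fst.tendsto _).comp he)) j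
  · rw [Model.sigma_eq (hL i j _)]
    exact tendsto_sigmaHat_of_tendsto_moments hC hn0 hc (hmu i j hc) (h2 i j hc)

lemma RegularPath.exists_limits (h : R.RegularPath S ω) (hC : R.Common c ω) (hn0 : 2 ≤ c.n0)
    (hσ : ∀ i j, 0 < S.sigma i j) (i : Fin K) (j : Fin D) :
    ∃ m s : ℝ, 0 < s ∧ Tendsto (fun r => R.muHat r ω i j) atTop (𝓝 m) ∧
      Tendsto (fun r => R.sigmaHat r ω i j) atTop (𝓝 s) ∧
      ((m = S.mu i j ∧ s = S.sigma i j) ∨ ¬ Tendsto (fun r => R.count r ω i j) atTop atTop ∧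
        ∀ᶠ r in atTop, R.muHat r ω i j = m) := by
  by_cases hc : Tendsto (fun r => R.count r ω i j) atTop atTop
  · have hc' := (tendsto_natCast_atTop_atTop (R := ℝ)).comp hc
    exact ⟨_, _, hσ i j, h.muHat i j hc', h.sigmaHat c hC hn0 i j hc', Or.inl ⟨rfl, rfl⟩⟩
  · obtain ⟨r₀, hr₀⟩ := eventually_atTop.1 ((not_frequently.1
      fun hf => hc (tendsto_count_of_frequently hf)).and (eventually_ge_atTop (c.init K D)))
    have hne : ∀ r ≥ r₀, R.pair r ω ≠ (i, j) := fun r hr => (hr₀ r hr).1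
    have hm : ∀ᶠ r in atTop, R.muHat r ω i j = R.muHat r₀ ω i j :=
      eventually_atTop.2 ⟨r₀, fun r hr => muHat_eq_of_pair_ne hne hr⟩
    have hs : ∀ᶠ r in atTop, R.sigmaHat r ω i j = R.sigmaHat r₀ ω i j :=
      eventually_atTop.2 ⟨r₀, fun r hr => sigmaHat_eq_of_pair_ne hne hr⟩
    exact ⟨_, _, sigmaHat_pos h.out_ne (two_le_count hC hn0 (hr₀ r₀ le_rfl).2 i j),
      tendsto_const_nhds.congr' (hm.mono fun r h => h.symm),
      tendsto_const_nhds.congr' (hs.mono fun r h => h.symm), Or.inr ⟨hc, hm⟩⟩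

lemma RegularPath.limits_ne (h : R.RegularPath S ω) (hC : R.Common c ω) (hn0 : 2 ≤ c.n0)
    (hdist : Function.Injective S.perfMean) {m : Fin K → Fin D → ℝ}
    (hm : ∀ i j, m i j = S.mu i j ∨ ∀ᶠ r in atTop, R.muHat r ω i j = m i j) :
    Function.Injective fun i => ∑ j, S.wc j * m i j := by
  classical
  intro i i' hii
  by_contra hne
  simp only at hii
  -- Pairs with a wrong limit are frozen; a tie becomes a relation among their outputs, with the
  -- true means of the other pairs as constant.
  set A : Finset (Fin K × Fin D) := Finset.univ.filter fun p => m p.1 p.2 ≠ S.mu p.1 p.2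
  have hA : ∀ p ∈ A, ∀ᶠ r in atTop, R.muHat r ω p.1 p.2 = m p.1 p.2 := fun p hp =>
    (hm p.1 p.2).resolve_left (Finset.mem_filter.1 hp).2
  obtain ⟨r, hr, hinit⟩ := (((Finset.eventually_all A).2 hA).and
    (eventually_ge_atTop (c.init K D))).exists
  have hcount : ∀ i j, R.count r ω i j ≠ 0 := fun i j => by
    have := two_le_count hC hn0 hinit i j
    omega
  have hzero : ∀ s < r, contrastCoef S.wc i i' A (R.count r ω) (R.pair s ω) = 0 := by
    by_contra! hex
    refine h.contrast_ne i i' A (R.count r ω) r hex ?_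
    rw [sum_contrastCoef_mul_out _ _ _ _ _ _ hcount, Finset.sum_congr rfl fun p hp => by
      rw [hr p hp], eq_neg_iff_add_eq_zero]
    have h1 : ∑ p ∈ Aᶜ, contrast S.wc i i' p * S.mu p.1 p.2 =
        ∑ p ∈ Aᶜ, contrast S.wc i i' p * m p.1 p.2 := by
      refine Finset.sum_congr rfl fun p hp => ?_
      have : m p.1 p.2 = S.mu p.1 p.2 := by simpa [A] using hp
      rw [this]
    rw [h1, Finset.sum_add_sum_compl, sum_contrast_mul, hii, sub_self]
  -- Every pair has already been simulated, so vanishing coefficients along the path leave no wrong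
  -- limit in either design's performance.
  have hnot : ∀ p, contrast S.wc i i' p ≠ 0 → m p.1 p.2 = S.mu p.1 p.2 := by
    rintro ⟨k, j⟩ hp
    by_contra hmp
    obtain ⟨s, hs⟩ := Finset.card_pos.1 (Nat.pos_of_ne_zero (hcount k j))
    have hs' := Finset.mem_filter.1 hs
    have h1 := hzero s (Finset.mem_range.1 hs'.1)
    rw [hs'.2, contrastCoef, if_pos (by simpa [A] using hmp)] at h1
    have h2 : (R.count r ω k j : ℝ) ≠ 0 := by exact_mod_cast hcount k j
    exact (div_ne_zero hp h2) h1
  refine hne (hdist ?_)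
  have h1 : ∀ j, m i j = S.mu i j := fun j => hnot (i, j) (by
    simpa [contrast, hne] using (S.wc_pos j).ne')
  have h2 : ∀ j, m i' j = S.mu i' j := fun j => hnot (i', j) (by
    simpa [contrast, Ne.symm hne] using (S.wc_pos j).ne')
  simpa only [Model.perfMean, h1, h2] using hii

/-- The bootstrap: `hcount` is applied to provisional limits, whose maximizer `b` need not yet be
the true best design, and then rules out frozen pairs. -/
lemma RegularPath.estimatesConverge (h : R.RegularPath S ω) (hC : R.Common c ω) (hn0 : 2 ≤ c.n0)
    (hK : 2 ≤ K) (hN : Tendsto c.N atTop atTop) (hσ : ∀ i j, 0 < S.sigma i j)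
    (hdist : Function.Injective S.perfMean)
    (hcount : ∀ (μ : Fin K → ℝ) (σ : Fin K → Fin D → ℝ) (b : Fin K),
      R.EstimatesConverge c ω S.wc μ σ → (∀ i, i ≠ b → μ i < μ b) →
        ∀ i j, Tendsto (fun r => R.count r ω i j) atTop atTop) :
    R.EstimatesConverge c ω S.wc S.perfMean S.sigma ∧
      ∀ i j, Tendsto (fun r => R.muHat r ω i j) atTop (𝓝 (S.mu i j)) := by
  choose m s hs hm hs' hor using h.exists_limits hC hn0 hσ
  have hE : R.EstimatesConverge c ω S.wc (fun i => ∑ j, S.wc j * m i j) s :=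
    { w_pos := S.wc_pos
      σ_pos := hs
      wHat := fun j => (h.wHat j).comp (Schedule.tendsto_stage hN K D)
      perfHat := fun i => tendsto_finsetSum _ fun j _ =>
        ((h.wHat j).comp (Schedule.tendsto_stage hN K D)).mul (hm i j)
      sigmaHat := hs' }
  have hinj := h.limits_ne hC hn0 hdist (m := m) fun i j => (hor i j).imp And.left And.right
  have : Nonempty (Fin K) := ⟨⟨0, by omega⟩⟩
  obtain ⟨b, hb⟩ := Finite.exists_max fun i => ∑ j, S.wc j * m i j
  have hc := hcount _ _ b hE fun i hi => lt_of_le_of_ne (hb i) fun he => hi (hinj he)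
  have hlim : ∀ i j, m i j = S.mu i j ∧ s i j = S.sigma i j := fun i j =>
    (hor i j).resolve_right fun hn => hn.1 (hc i j)
  have hm' : m = S.mu := by ext i j; exact (hlim i j).1
  have hs'' : s = S.sigma := by ext i j; exact (hlim i j).2
  subst hm' hs''
  exact ⟨hE, hm⟩

lemma RegularPath.selectsEventually (h : R.RegularPath S ω) (hC : R.Common c ω)
    (hN : Tendsto c.N atTop atTop) {b : Fin K} (hb : ∀ i, i ≠ b → S.perfMean i < S.perfMean b)
    (hE : R.EstimatesConverge c ω S.wc S.perfMean S.sigma)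
    (hm : ∀ i j, Tendsto (fun r => R.muHat r ω i j) atTop (𝓝 (S.mu i j))) :
    R.SelectsEventually c b ω := by
  constructor
  · have h1 : Tendsto (fun t => c.init K D + c.N t) atTop atTop :=
      tendsto_atTop_mono (fun t => Nat.le_add_left _ _) hN
    have h2 : ∀ i, Tendsto (fun t => R.perfHat t (c.init K D + c.N t) ω i) atTop
        (𝓝 (S.perfMean i)) := fun i =>
      tendsto_finsetSum _ fun j _ => (h.wHat j).mul ((hm i j).comp h1)
    refine eventually_all.2 fun i => ?_
    by_cases hi : i = b
    · simp [hi]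
    · filter_upwards [(h2 i).eventually_lt (h2 b) (hb i hi)] with t ht _ using ht
  · exact (tendsto_atTop_mono (fun l => Nat.le_add_left l (c.init K D)) tendsto_id).eventually
      (hE.eventually_bHat_eq hC hb)

end Limits

end Execution

end IUOCBA

end

/-! ### Assembly -/

theorem proposition2 {K D : ℕ} {Ξ Θ Ω : Type*} [MeasurableSpace Ξ]
    [MetricSpace Θ] [CompactSpace Θ] [MeasurableSpace Θ] [BorelSpace Θ]
    [MeasurableSpace Ω] (P : Measure Ω) [IsProbabilityMeasure P]
    (S : IUOCBA.Model K D Ξ Θ) (c : IUOCBA.Schedule)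
    (hK : 2 ≤ K) (hn0 : 2 ≤ c.n0)
    (hN : Tendsto c.N atTop atTop) (hM : Tendsto c.M atTop atTop)
    (hmom : S.MomentsContinuous)
    (hatom : ∀ i j θ x, S.outLaw i j θ {x} = 0)
    (hdist : Function.Injective S.perfMean)
    (b : Fin K) (hb : ∀ i, i ≠ b → S.perfMean i < S.perfMean b)
    (R : IUOCBA.Execution K D Ξ Θ Ω)
    (hmeas : R.IsMeasurable)
    (hdata : R.DataIID S P)
    (hMLE : R.EstimatesAreMLE S c P)
    (hcons : Tendsto c.M atTop atTop → ∀ᵐ ω ∂P,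
      Tendsto (fun t => (R.wHat t ω, R.θHat t ω)) atTop (𝓝 (S.wc, S.θc)))
    (hsim : R.SimulatesCurrentEstimate S c P) :
    ((∀ᵐ ω ∂P, R.FollowsApprox c ω) →
      (∀ᵐ ω ∂P, R.SelectsEventually c b ω) ∧
      ∃ α : Fin K → Fin D → ℝ,
        IUOCBA.IsApproxAllocation S.wc S.perfMean S.sigma b α ∧
        ∀ᵐ ω ∂P, ∀ i j, Tendsto (fun l => R.alpha c l ω i j) atTop (𝓝 (α i j))) ∧
    ((∀ᵐ ω ∂P, R.FollowsBalance c ω) →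
      (∀ᵐ ω ∂P, R.SelectsEventually c b ω) ∧
      (∀ᵐ ω ∂P, ∀ i, i ≠ b → ∀ j j', Tendsto (fun l =>
        |R.alpha c l ω i j / (S.sigma i j * S.wc j) -
          R.alpha c l ω i j' / (S.sigma i j' * S.wc j')|) atTop (𝓝 0)) ∧
      (∀ᵐ ω ∂P, ∀ j, Tendsto (fun l =>
        |(R.alpha c l ω b j / S.sigma b j) ^ 2 -
          ∑ i with i ≠ b, (R.alpha c l ω i j / S.sigma i j) ^ 2|) atTop (𝓝 0))) := by
  have hD := S.pos_of_wc_sum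
  have hσ : ∀ i j, 0 < S.sigma i j := fun i j =>
    IUOCBA.Model.sigma_pos ((hmom i j).1 _) (hatom i j _)
  have hpath := IUOCBA.Execution.ae_regularPath hmeas hN hsim hmom hatom (hcons hM)
  have hshift : Tendsto (fun l => c.init K D + l) atTop atTop :=
    tendsto_atTop_mono (fun l => Nat.le_add_left l _) tendsto_id
  constructor
  · intro hfol
    have hE : ∀ᵐ ω ∂P, R.EstimatesConverge c ω S.wc S.perfMean S.sigma ∧
        ∀ i j, Tendsto (fun r => R.muHat r ω i j) atTop (𝓝 (S.mu i j)) := by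
      filter_upwards [hpath, hfol] with ω h1 h2
      exact h1.estimatesConverge h2.toCommon hn0 hK hN hσ hdist
        fun μ σ b' hE hb' => h2.tendsto_count hE hb' hK hD
    refine ⟨?_, _, IUOCBA.isApproxAllocation_approxAlloc hK S.wc_pos hσ hb hD, ?_⟩
    · filter_upwards [hpath, hfol, hE] with ω h1 h2 h3
      exact h1.selectsEventually h2.toCommon hN hb h3.1 h3.2
    · filter_upwards [hfol, hE] with ω h2 h3 i j
      exact (h2.tendsto_count_div h3.1 hb hK hD i j).comp hshift
  · intro hfol
    have hE : ∀ᵐ ω ∂P, R.EstimatesConverge c ω S.wc S.perfMean S.sigma ∧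
        ∀ i j, Tendsto (fun r => R.muHat r ω i j) atTop (𝓝 (S.mu i j)) := by
      filter_upwards [hpath, hfol] with ω h1 h2
      exact h1.estimatesConverge h2.toCommon hn0 hK hN hσ hdist
        fun μ σ b' hE hb' => h2.tendsto_count hE hb' hD (by omega)
    refine ⟨?_, ?_, ?_⟩
    · filter_upwards [hpath, hfol, hE] with ω h1 h2 h3
      exact h1.selectsEventually h2.toCommon hN hb h3.1 h3.2
    · filter_upwards [hfol, hE] with ω h2 h3 i _ j j'
      have h4 := ((h2.tendsto_component h3.1 i j j').abs).comp hshift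
      rw [abs_zero] at h4
      exact h4
    · filter_upwards [hfol, hE] with ω h2 h3 j
      have h4 := ((h2.tendsto_limitGap h3.1 (h3.1.eventually_bHat_eq h2.toCommon hb) j).abs).comp
        hshift
      rw [abs_zero] at h4
      exact h4
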